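/- Let $(E,\mathcal M,\mathbf m)$ be a separable probability space, write $L^p(\mathbf m)$ for the real $L^p$-spaces and $\langle\cdot,\cdot\rangle$ for the inner product of $L^2(\mathbf m)$, and let $(L,\mathcal D(L))$ be a negative definite self-adjoint operator on $L^2(\mathbf m)$ with discrete spectrum, i.e. $L^2(\mathbf m)$ has a (finite or countable) orthonormal basis $\{e_i\}$ of eigenfunctions, $-Le_i=\lambda_i e_i$ with $\lambda_i>0$, such that $\{i:\lambda_i\le R\}$ is finite for every $R$. Let $H$ be the completion of $L^2(\mathbf m)$ under the inner product $$\langle x,y\rangle_H=\sum_i\frac1{\lambda_i}\langle x,e_i\rangle\langle y,e_i\rangle .$$ For $\alpha\in\mathbb R$ let $(-L)^{\alpha}f=\sum_i\lambda_i^{\alpha}\langle f,e_i\rangle e_i$ for all $f\in L^2(\mathbf m)$ with $\sum_i\lambda_i^{2\alpha}\langle f,e_i\rangle^2<\infty$. A closed, densely defined operator $A$ on $L^2(\mathbf m)$ is called a Dirichlet operator if $\langle Au,(u-1)^+\rangle\le 0$ for all $u\in\mathcal D(A)$. Let $r\in(0,1)$. Assume that for some $d\in\bigl(0,\frac{2(r+1)}{1-r}\bigr)$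 and some constant $C>0$ the Nash inequality $$\|f\|_2^{2+4/d}\le C\langle f,-Lf\rangle,\qquad f\in\mathcal D(L),\ \mathbf m(|f|)=1,$$ holds, and that $-(-L)^{1/n}$ is a Dirichlet operator for some integer $n\ge1$. Then the embedding $L^{r+1}(\mathbf m)\subset H$ exists and is compact: there is an injective compact linear operator $J:L^{r+1}(\mathbf m)\to H$ which on $L^2(\mathbf m)\subset L^{r+1}(\mathbf m)$ is the canonical inclusion $L^2(\mathbf m)\subset H$. Moreover $(-L)^{-1}$ extends to a bounded operator from $L^{r+1}(\mathbf m)$ to $L^{(r+1)/r}(\mathbf m)$, and, writing $\|x\|_H:=\|Jx\|_H$ and $\langle x,y\rangle=\int_E xy\,d\mathbf m$, one has for some constant $c>0$ $$\|x\|_H=\langle x,(-L)^{-1}x\rangle^{1/2}\le c\,\|x\|_{r+1},\qquad x\in L^{r+1}(\mathbf m).$$ -/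

import Mathlib

open MeasureTheory
open scoped InnerProductSpace ENNReal

noncomputable section

section Operators

variable {F : Type*} [NormedAddCommGroup F] [InnerProductSpace ℝ F]

/-- `L` is negative definite: `⟨f, L f⟩ < 0` for every nonzero `f` in the domain of `L`. -/
def IsNegativeDefinite (L : F →ₗ.[ℝ] F) : Prop :=
  ∀ f : L.domain, (f : F) ≠ 0 → ⟪(f : F), L f⟫_ℝ < 0

/-- A complete system of eigenvectors of an operator `L` with discrete spectrum, where `-L` has
positive eigenvalues: an orthonormal basis `e i` of eigenvectors of `L`, with
`-L (e i) = eig i • e i` and `eig i > 0`, such that only finitely many of the eigenvalues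
(counted with multiplicity) lie below any given bound. The index type `ι` may be finite or
infinite. -/
structure DiscreteSpectrum (ι : Type*) (L : F →ₗ.[ℝ] F) where
  /-- the unit eigenvectors -/
  e : HilbertBasis ι ℝ F
  /-- the eigenvalues of `-L`, counted with multiplicity -/
  eig : ι → ℝ
  eig_pos : ∀ i, 0 < eig i
  mem_domain : ∀ i, e i ∈ L.domain
  neg_apply : ∀ i, -(L ⟨e i, mem_domain i⟩) = eig i • e i
  finite_eig_le : ∀ R : ℝ, {i | eig i ≤ R}.Finite

namespace DiscreteSpectrum

variable {ι : Type*} {L : F →ₗ.[ℝ] F} (S : DiscreteSpectrum ι L)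

/-- The fractional power `(-L) ^ a`, defined through the spectral decomposition: its domain is
`{f | ∑ i, (eig i ^ a * ⟨e i, f⟩) ^ 2 < ∞}` and
`(-L) ^ a f = ∑ i, (eig i ^ a * ⟨e i, f⟩) • e i`. -/
def negPow (a : ℝ) : F →ₗ.[ℝ] F where
  domain :=
    { carrier := {f | Memℓp (fun i => S.eig i ^ a * ⟪S.e i, f⟫_ℝ) 2}
      zero_mem' := by
        have h : (fun i => S.eig i ^ a * ⟪S.e i, (0 : F)⟫_ℝ) = 0 := by
          funext i; simp
        change Memℓp _ 2
        rw [h]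
        exact zero_memℓp
      add_mem' := by
        intro f g hf hg
        have h : (fun i => S.eig i ^ a * ⟪S.e i, f + g⟫_ℝ) =
            (fun i => S.eig i ^ a * ⟪S.e i, f⟫_ℝ) + fun i => S.eig i ^ a * ⟪S.e i, g⟫_ℝ := by
          funext i; simp [inner_add_right, mul_add]
        change Memℓp _ 2
        rw [h]
        exact hf.add hg
      smul_mem' := by
        intro c f hf
        have h : (fun i => S.eig i ^ a * ⟪S.e i, c • f⟫_ℝ) =
            c • fun i => S.eig i ^ a * ⟪S.e i, f⟫_ℝ := by
          funext i; simp [inner_smul_right]; ring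
        change Memℓp _ 2
        rw [h]
        exact hf.const_smul c }
  toFun :=
    { toFun := fun f => S.e.repr.symm ⟨fun i => S.eig i ^ a * ⟪S.e i, (f : F)⟫_ℝ, f.2⟩
      map_add' := by
        intro f g
        rw [← map_add]
        congr 1
        ext i
        change S.eig i ^ a * ⟪S.e i, (f : F) + (g : F)⟫_ℝ =
          S.eig i ^ a * ⟪S.e i, (f : F)⟫_ℝ + S.eig i ^ a * ⟪S.e i, (g : F)⟫_ℝ
        rw [inner_add_right, mul_add]
      map_smul' := by
        intro c f
        rw [RingHom.id_apply, ← map_smul]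
        congr 1
        ext i
        simp [inner_smul_right]
        ring }

theorem exists_inv_eig_le : ∃ K : ℝ, ∀ i, 1 / S.eig i ≤ K := by
  classical
  have hfin := S.finite_eig_le 1
  refine ⟨1 + ∑ j ∈ hfin.toFinset, 1 / S.eig j, fun i => ?_⟩
  have hnn : ∀ j ∈ hfin.toFinset, 0 ≤ 1 / S.eig j :=
    fun j _ => (one_div_pos.2 (S.eig_pos j)).le
  by_cases hi : S.eig i ≤ 1
  · have h1 : 1 / S.eig i ≤ ∑ j ∈ hfin.toFinset, 1 / S.eig j :=
      Finset.single_le_sum hnn (hfin.mem_toFinset.2 hi)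
    linarith
  · have h1 : 1 / S.eig i ≤ 1 := by
      rw [div_le_one (S.eig_pos i)]
      linarith
    have h2 := Finset.sum_nonneg hnn
    linarith

theorem summable_inner (x y : F) :
    Summable fun i => 1 / S.eig i * (⟪x, S.e i⟫_ℝ * ⟪y, S.e i⟫_ℝ) := by
  obtain ⟨K, hK⟩ := S.exists_inv_eig_le
  have h0 : Summable fun i => ⟪x, S.e i⟫_ℝ * ⟪y, S.e i⟫_ℝ := by
    have := S.e.summable_inner_mul_inner x y
    simpa only [real_inner_comm y] using this
  refine Summable.of_norm_bounded (g := fun i => K * ‖⟪x, S.e i⟫_ℝ * ⟪y, S.e i⟫_ℝ‖)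
    (h0.norm.mul_left K) fun i => ?_
  rw [norm_mul, Real.norm_of_nonneg (one_div_pos.2 (S.eig_pos i)).le]
  exact mul_le_mul_of_nonneg_right (hK i) (norm_nonneg _)

/-- The inner product `⟨x, y⟩_H = ∑ i, (1 / eig i) * ⟨x, e i⟩ * ⟨y, e i⟩`. -/
def innerH (x y : F) : ℝ := ∑' i, 1 / S.eig i * (⟪x, S.e i⟫_ℝ * ⟪y, S.e i⟫_ℝ)

theorem innerH_comm (x y : F) : S.innerH y x = S.innerH x y :=
  tsum_congr fun i => by ring

theorem innerH_self_nonneg (x : F) : 0 ≤ S.innerH x x :=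
  tsum_nonneg fun i => mul_nonneg (one_div_pos.2 (S.eig_pos i)).le (mul_self_nonneg _)

theorem innerH_add_left (x y z : F) : S.innerH (x + y) z = S.innerH x z + S.innerH y z := by
  unfold innerH
  rw [← (S.summable_inner x z).tsum_add (S.summable_inner y z)]
  exact tsum_congr fun i => by rw [inner_add_left]; ring

theorem innerH_smul_left (x y : F) (c : ℝ) : S.innerH (c • x) y = c * S.innerH x y := by
  unfold innerH
  rw [← tsum_mul_left]
  exact tsum_congr fun i => by rw [real_inner_smul_left]; ring

theorem eq_zero_of_innerH_self (x : F) (hx : S.innerH x x = 0) : x = 0 := by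
  have hnn : ∀ i, 0 ≤ 1 / S.eig i * (⟪x, S.e i⟫_ℝ * ⟪x, S.e i⟫_ℝ) := fun i =>
    mul_nonneg (one_div_pos.2 (S.eig_pos i)).le (mul_self_nonneg _)
  have hs := (S.summable_inner x x).hasSum
  unfold innerH at hx
  rw [hx] at hs
  have h := (hasSum_zero_iff_of_nonneg hnn).1 hs
  have : S.e.repr x = 0 := by
    ext i
    have hi := congrFun h i
    simp only [Pi.zero_apply, mul_eq_zero, one_div, inv_eq_zero, (S.eig_pos i).ne',
      false_or, or_self] at hi
    rw [S.e.repr_apply_apply, real_inner_comm, hi]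
    rfl
  exact (map_eq_zero_iff S.e.repr S.e.repr.injective).1 this

/-- The space on which `L` acts, to be equipped with the weaker inner product `innerH`. -/
def PreH (_S : DiscreteSpectrum ι L) : Type _ := F

instance : AddCommGroup S.PreH := inferInstanceAs (AddCommGroup F)

instance : Module ℝ S.PreH := inferInstanceAs (Module ℝ F)

/-- The inner product axioms for `innerH`. -/
@[reducible]
def coreH : InnerProductSpace.Core ℝ S.PreH where
  inner x y := S.innerH x y
  conj_inner_symm x y := S.innerH_comm x y
  re_inner_nonneg x := S.innerH_self_nonneg x
  add_left x y z := S.innerH_add_left x y z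
  smul_left x y c := S.innerH_smul_left x y c
  definite x hx := S.eq_zero_of_innerH_self x hx

instance : NormedAddCommGroup S.PreH := S.coreH.toNormedAddCommGroup

instance : InnerProductSpace ℝ S.PreH := InnerProductSpace.ofCore S.coreH.toCore

/-- The Hilbert space `H`: the completion under the inner product `innerH`. -/
abbrev H : Type _ := UniformSpace.Completion S.PreH

/-- The identity map from the original space onto its copy `PreH`. -/
def toPreH : F ≃ₗ[ℝ] S.PreH where
  toFun x := x
  invFun x := x
  map_add' _ _ := rfl
  map_smul' _ _ := rfl
  left_inv _ := rfl
  right_inv _ := rfl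

/-- The canonical inclusion of the original space into its completion `H`. -/
def toH (x : F) : S.H := (S.toPreH x : UniformSpace.Completion S.PreH)

end DiscreteSpectrum

end Operators

section Lebesgue

variable {E : Type*} [MeasurableSpace E] {m : Measure E}

/-- A Dirichlet operator on `L²(m)`: a closed, densely defined operator `A` such that
`⟨A u, (u - 1)⁺⟩ ≤ 0` for every `u` in its domain. -/
def IsDirichletOperator (A : Lp ℝ 2 m →ₗ.[ℝ] Lp ℝ 2 m) : Prop :=
  Dense (A.domain : Set (Lp ℝ 2 m)) ∧ A.IsClosed ∧
    ∀ u : A.domain, ∫ x, A u x * max ((u : Lp ℝ 2 m) x - 1) 0 ∂m ≤ 0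

/-- The Nash inequality of dimension `d` for `L`: with some constant `C > 0`,
`‖f‖₂ ^ (2 + 4 / d) ≤ C * ⟨f, -L f⟩` for all `f` in the domain of `L` with `m(|f|) = 1`. -/
def NashInequality (L : Lp ℝ 2 m →ₗ.[ℝ] Lp ℝ 2 m) (d : ℝ) : Prop :=
  ∃ C : ℝ, 0 < C ∧ ∀ f : L.domain, ∫ x, |(f : Lp ℝ 2 m) x| ∂m = 1 →
    ‖(f : Lp ℝ 2 m)‖ ^ (2 + 4 / d) ≤ C * ⟪(f : Lp ℝ 2 m), -(L f)⟫_ℝ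

instance fact_one_le_add_one (r : ℝ) [h : Fact (r ∈ Set.Ioo (0 : ℝ) 1)] :
    Fact (1 ≤ ENNReal.ofReal (r + 1)) :=
  ⟨by rw [ENNReal.one_le_ofReal]; linarith [h.out.1]⟩

instance fact_one_le_dual (r : ℝ) [h : Fact (r ∈ Set.Ioo (0 : ℝ) 1)] :
    Fact (1 ≤ ENNReal.ofReal ((r + 1) / r)) :=
  ⟨by rw [ENNReal.one_le_ofReal, le_div_iff₀ h.out.1]; linarith⟩

end Lebesgue

end

/-! Put `B = (-L)^{1/n}`, with eigenvalues `μ i`, `T_t = exp(-tB)` and `p = r + 1`. Since `μ i ^ n =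
eig i`, `‖x‖_H² = ∑ (μ i ^ n)⁻¹ ⟪e i, x⟫²`, and everything rests on controlling the tails of this
sum by `‖x‖_p²`.

The Dirichlet condition makes the resolvents of `B`, hence `T_t`, contract the `L^∞` norm; by
symmetry `T_t` contracts the `L¹` norm. The Nash inequality concerns `-L = B^n`, but it can be
applied along `T_t`: it yields `‖T_t f‖₂ ≤ C t^{-nd/4} ‖f‖₁` (`exists_norm_semigroupOp_le`).
Interpolation with the `L²` contraction gives `‖T_t f‖₂ ≤ C t^{-α} ‖f‖_p` with `α = (nd/4)(2/p - 1)`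
(`norm_le_of_L1_bound`).

On the dyadic shell `μ i ≈ 2^k`, taking `t = 2^{-k}` costs only a constant, so the shell contributes
at most `C 2^{(2α - n)k} ‖f‖_p²`. The condition on `d` says exactly `2α < n`, and the shells sum
geometrically (`exists_tail_bound`).

The whole sum bounds the embedding; its decaying tails make it a norm limit of finite-rank maps,
hence compact. Converse Hölder turns `⟪(-L)⁻¹x, y⟫ = ⟪x, y⟫_H` into boundedness of `(-L)⁻¹` into the
dual space. For injectivity, an `x` in the kernel annihilates the range of `(-L)⁻¹`, which contains
every `T_t g`; letting `t → 0` with `g = sign x` gives `x = 0`. -/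

noncomputable section

/-! ### Diagonal operators in a Hilbert basis -/

namespace HilbertBasis

variable {ι F : Type*} [NormedAddCommGroup F] [InnerProductSpace ℝ F] (b : HilbertBasis ι ℝ F)

theorem ext_inner {f g : F} (h : ∀ i, ⟪b i, f⟫_ℝ = ⟪b i, g⟫_ℝ) : f = g := by
  apply b.repr.injective
  ext i
  simpa only [b.repr_apply_apply] using h i

theorem hasSum_sq_inner (f : F) : HasSum (fun i => ⟪b i, f⟫_ℝ ^ 2) (‖f‖ ^ 2) := by
  have := b.hasSum_inner_mul_inner f f
  rw [real_inner_self_eq_norm_sq] at this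
  simpa only [real_inner_comm (b _) f, ← sq] using this

theorem exists_inner_eq {v : ι → ℝ} (hv : Summable fun i => v i ^ 2) :
    ∃ f : F, ∀ i, ⟪b i, f⟫_ℝ = v i := by
  have h : Memℓp v 2 := by
    apply memℓp_gen
    simpa using hv
  exact ⟨b.repr.symm ⟨v, h⟩, fun i => by rw [← b.repr_apply_apply]; simp⟩

theorem summable_sq_mul {φ : ι → ℝ} (hφ : ∃ K, ∀ i, |φ i| ≤ K) (f : F) :
    Summable fun i => (φ i * ⟪b i, f⟫_ℝ) ^ 2 := by
  obtain ⟨K, hK⟩ := hφ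
  refine Summable.of_nonneg_of_le (fun i => sq_nonneg _) (fun i => ?_)
    ((b.hasSum_sq_inner f).summable.mul_left (K ^ 2))
  rw [mul_pow]
  exact mul_le_mul_of_nonneg_right
    (sq_le_sq' (by linarith [neg_le_of_abs_le (hK i)]) (le_of_abs_le (hK i))) (sq_nonneg _)

/-- The diagonal operator with bounded multiplier `φ` in the basis `b`
(zero if `φ` is unbounded). -/
def diag (φ : ι → ℝ) : F →ₗ[ℝ] F := by
  classical exact
  if hφ : ∃ K, ∀ i, |φ i| ≤ K then
    { toFun := fun f => (b.exists_inner_eq (b.summable_sq_mul hφ f)).choose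
      map_add' := fun f g => b.ext_inner fun i => by
        rw [inner_add_right, (b.exists_inner_eq (b.summable_sq_mul hφ (f + g))).choose_spec i,
          (b.exists_inner_eq (b.summable_sq_mul hφ f)).choose_spec i,
          (b.exists_inner_eq (b.summable_sq_mul hφ g)).choose_spec i, inner_add_right, mul_add]
      map_smul' := fun c f => b.ext_inner fun i => by
        rw [RingHom.id_apply, inner_smul_right,
          (b.exists_inner_eq (b.summable_sq_mul hφ (c • f))).choose_spec i,
          (b.exists_inner_eq (b.summable_sq_mul hφ f)).choose_spec i, inner_smul_right]
        ring }
  else 0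

variable {φ ψ : ι → ℝ}

theorem inner_diag (hφ : ∃ K, ∀ i, |φ i| ≤ K) (f : F) (i : ι) :
    ⟪b i, b.diag φ f⟫_ℝ = φ i * ⟪b i, f⟫_ℝ := by
  rw [diag, dif_pos hφ]
  exact (b.exists_inner_eq (b.summable_sq_mul hφ f)).choose_spec i

theorem hasSum_inner_diag (hφ : ∃ K, ∀ i, |φ i| ≤ K) (f g : F) :
    HasSum (fun i => φ i * (⟪b i, f⟫_ℝ * ⟪b i, g⟫_ℝ)) ⟪b.diag φ f, g⟫_ℝ := by
  have := b.hasSum_inner_mul_inner (b.diag φ f) g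
  simp only [real_inner_comm _ (b.diag φ f), b.inner_diag hφ, mul_assoc] at this
  rwa [real_inner_comm]

theorem hasSum_norm_sq_diag (hφ : ∃ K, ∀ i, |φ i| ≤ K) (f : F) :
    HasSum (fun i => φ i ^ 2 * ⟪b i, f⟫_ℝ ^ 2) (‖b.diag φ f‖ ^ 2) := by
  have := b.hasSum_sq_inner (b.diag φ f)
  simpa only [b.inner_diag hφ, mul_pow] using this

theorem inner_diag_comm (hφ : ∃ K, ∀ i, |φ i| ≤ K) (f g : F) :
    ⟪b.diag φ f, g⟫_ℝ = ⟪f, b.diag φ g⟫_ℝ := by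
  rw [← (b.hasSum_inner_diag hφ f g).tsum_eq, real_inner_comm,
    ← (b.hasSum_inner_diag hφ g f).tsum_eq]
  exact tsum_congr fun i => by ring

theorem exists_abs_mul_le (hφ : ∃ K, ∀ i, |φ i| ≤ K) (hψ : ∃ K, ∀ i, |ψ i| ≤ K) :
    ∃ K, ∀ i, |φ i * ψ i| ≤ K := by
  obtain ⟨K, hK⟩ := hφ
  obtain ⟨K', hK'⟩ := hψ
  refine ⟨K * K', fun i => ?_⟩
  rw [abs_mul]
  exact mul_le_mul (hK i) (hK' i) (abs_nonneg _) ((abs_nonneg _).trans (hK i))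

theorem diag_diag (hφ : ∃ K, ∀ i, |φ i| ≤ K) (hψ : ∃ K, ∀ i, |ψ i| ≤ K) (f : F) :
    b.diag φ (b.diag ψ f) = b.diag (fun i => φ i * ψ i) f :=
  b.ext_inner fun i => by
    rw [b.inner_diag hφ, b.inner_diag hψ, b.inner_diag (exists_abs_mul_le hφ hψ), mul_assoc]

theorem norm_diag_le {K : ℝ} (hK0 : 0 ≤ K) (hK : ∀ i, |φ i| ≤ K) (f : F) :
    ‖b.diag φ f‖ ≤ K * ‖f‖ := by
  refine (sq_le_sq₀ (norm_nonneg _) (by positivity)).1 ?_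
  rw [mul_pow]
  refine hasSum_le (fun i => ?_) (b.hasSum_norm_sq_diag ⟨K, hK⟩ f)
    ((b.hasSum_sq_inner f).mul_left (K ^ 2))
  exact mul_le_mul_of_nonneg_right
    (sq_le_sq' (by linarith [neg_le_of_abs_le (hK i)]) (le_of_abs_le (hK i))) (sq_nonneg _)

/-- Strong convergence of diagonal operators with uniformly bounded, pointwise convergent
multipliers. -/
theorem tendsto_diag {φs : ℕ → ι → ℝ} {K : ℝ} (hs : ∀ k i, |φs k i| ≤ K) (hφ : ∀ i, |φ i| ≤ K)
    (h : ∀ i, Filter.Tendsto (fun k => φs k i) Filter.atTop (nhds (φ i))) (f : F) :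
    Filter.Tendsto (fun k => b.diag (φs k) f) Filter.atTop (nhds (b.diag φ f)) := by
  rw [tendsto_iff_norm_sub_tendsto_zero]
  have hsum : ∀ k, HasSum (fun i => (φs k i - φ i) ^ 2 * ⟪b i, f⟫_ℝ ^ 2)
      (‖b.diag (φs k) f - b.diag φ f‖ ^ 2) := by
    intro k
    have := b.hasSum_sq_inner (b.diag (φs k) f - b.diag φ f)
    simpa only [inner_sub_right, b.inner_diag ⟨K, hs k⟩, b.inner_diag ⟨K, hφ⟩, ← sub_mul,
      mul_pow] using this
  have hlim : Filter.Tendsto (fun k => ‖b.diag (φs k) f - b.diag φ f‖ ^ 2) Filter.atTop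
      (nhds 0) := by
    have h0 := tendsto_tsum_of_dominated_convergence (𝓕 := Filter.atTop)
      (f := fun k i => (φs k i - φ i) ^ 2 * ⟪b i, f⟫_ℝ ^ 2) (g := fun _ => (0 : ℝ))
      (bound := fun i => (2 * K) ^ 2 * ⟪b i, f⟫_ℝ ^ 2)
      ((b.hasSum_sq_inner f).summable.mul_left _)
      (fun i => by
        have := (((h i).sub_const (φ i)).pow 2).mul_const (⟪b i, f⟫_ℝ ^ 2)
        simpa using this)
      (Filter.Eventually.of_forall fun k i => by
        rw [Real.norm_of_nonneg (by positivity)]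
        have h1 := abs_le.1 (hs k i)
        have h2 := abs_le.1 (hφ i)
        gcongr ?_ * _
        exact sq_le_sq' (by linarith) (by linarith))
    simpa only [(hsum _).tsum_eq, tsum_zero] using h0
  have := hlim.sqrt
  simpa using this

end HilbertBasis

/-! ### Pairings on `L²` and duality between `L¹` and `L^∞` -/

section Lebesgue

variable {E : Type*} [MeasurableSpace E] {m : Measure E}

theorem inner_L2_eq_integral (f g : Lp ℝ 2 m) : ⟪f, g⟫_ℝ = ∫ x, f x * g x ∂m := by
  rw [L2.inner_def]
  exact integral_congr_ae (Filter.Eventually.of_forall fun x => by simp [mul_comm])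

theorem integrable_mul_L2 (f g : Lp ℝ 2 m) : Integrable (fun x => f x * g x) m :=
  (Lp.memLp f).integrable_mul (Lp.memLp g)

theorem ae_abs_le_of_tendsto_L2 {g : ℕ → Lp ℝ 2 m} {g' : Lp ℝ 2 m} {c : ℝ}
    (h : Filter.Tendsto g Filter.atTop (nhds g')) (hg : ∀ k, ∀ᵐ x ∂m, |g k x| ≤ c) :
    ∀ᵐ x ∂m, |g' x| ≤ c := by
  obtain ⟨ns, -, hns⟩ := (tendstoInMeasure_of_tendsto_Lp h).exists_seq_tendsto_ae
  filter_upwards [hns, ae_all_iff.2 hg] with x hx hgx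
  exact le_of_tendsto hx.abs (Filter.Eventually.of_forall fun k => hgx _)

variable [IsProbabilityMeasure m]

theorem integrable_L2 (f : Lp ℝ 2 m) : Integrable f m :=
  (Lp.memLp f).integrable (by norm_num)

/-- A bounded `L²` function realising the `L¹` norm by duality. -/
theorem exists_inner_eq_integral_abs (f : Lp ℝ 2 m) :
    ∃ s : Lp ℝ 2 m, (∀ᵐ x ∂m, |s x| ≤ 1) ∧ ⟪f, s⟫_ℝ = ∫ x, |f x| ∂m := by
  have hs : Measurable fun x => if 0 ≤ f x then (1 : ℝ) else -1 :=
    Measurable.ite (measurableSet_le measurable_const (Lp.stronglyMeasurable f).measurable)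
      measurable_const measurable_const
  have hb : ∀ x, |if 0 ≤ f x then (1 : ℝ) else -1| ≤ 1 := fun x => by split_ifs <;> simp
  have hL : MemLp (fun x => if 0 ≤ f x then (1 : ℝ) else -1) 2 m :=
    MemLp.of_bound hs.aestronglyMeasurable 1 (Filter.Eventually.of_forall hb)
  refine ⟨hL.toLp, ?_, ?_⟩
  · filter_upwards [hL.coeFn_toLp] with x hx
    rw [hx]; exact hb x
  · rw [inner_L2_eq_integral]
    refine integral_congr_ae ?_
    filter_upwards [hL.coeFn_toLp] with x hx
    rw [hx]
    split_ifs with h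
    · rw [abs_of_nonneg h, mul_one]
    · rw [abs_of_neg (not_le.1 h)]; ring

/-- A symmetric operator which contracts bounded functions contracts the `L¹` norm. -/
theorem integral_abs_le_of_symm {T : Lp ℝ 2 m → Lp ℝ 2 m}
    (hsymm : ∀ f g, ⟪T f, g⟫_ℝ = ⟪f, T g⟫_ℝ)
    (hT : ∀ g : Lp ℝ 2 m, (∀ᵐ x ∂m, |g x| ≤ 1) → ∀ᵐ x ∂m, |T g x| ≤ 1) (f : Lp ℝ 2 m) :
    ∫ x, |T f x| ∂m ≤ ∫ x, |f x| ∂m := by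
  obtain ⟨s, hs, hs'⟩ := exists_inner_eq_integral_abs (T f)
  rw [← hs', hsymm, inner_L2_eq_integral]
  refine integral_mono_ae (integrable_mul_L2 _ _) (integrable_L2 f).abs ?_
  filter_upwards [hT s hs] with x hx
  calc f x * T s x ≤ |f x * T s x| := le_abs_self _
    _ = |f x| * |T s x| := abs_mul _ _
    _ ≤ |f x| * 1 := by gcongr
    _ = |f x| := mul_one _

end Lebesgue

/-! ### From the Dirichlet condition to contraction semigroups -/

section Semigroup

variable {E : Type*} [MeasurableSpace E] {m : Measure E}
  {ι : Type*} (b : HilbertBasis ι ℝ (Lp ℝ 2 m)) (μ : ι → ℝ)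

/-- The diagonal operator with eigenvalues `-μ i` satisfies the Dirichlet condition. -/
def DiagDirichlet : Prop :=
  ∀ u g : Lp ℝ 2 m, (∀ i, ⟪b i, g⟫_ℝ = -(μ i * ⟪b i, u⟫_ℝ)) →
    ∫ x, g x * max (u x - 1) 0 ∂m ≤ 0

/-- The resolvent `(1 + t B)⁻¹` of the diagonal operator `B` with eigenvalues `μ i`. -/
def resolventOp (t : ℝ) : Lp ℝ 2 m →ₗ[ℝ] Lp ℝ 2 m := b.diag fun i => (1 + t * μ i)⁻¹

/-- The semigroup `exp (-t B)` of the diagonal operator `B` with eigenvalues `μ i`. -/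
def semigroupOp (t : ℝ) : Lp ℝ 2 m →ₗ[ℝ] Lp ℝ 2 m := b.diag fun i => Real.exp (-(t * μ i))

variable {b μ}

theorem abs_inv_one_add_le (hμ : ∀ i, 0 < μ i) {t : ℝ} (ht : 0 ≤ t) (i : ι) :
    |(1 + t * μ i)⁻¹| ≤ 1 := by
  have h := mul_nonneg ht (hμ i).le
  rw [abs_of_nonneg (by positivity)]
  exact inv_le_one_of_one_le₀ (by linarith)

theorem abs_exp_neg_le (hμ : ∀ i, 0 < μ i) {t : ℝ} (ht : 0 ≤ t) (i : ι) :
    |Real.exp (-(t * μ i))| ≤ 1 := by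
  rw [Real.abs_exp, Real.exp_le_one_iff]
  linarith [mul_nonneg ht (hμ i).le]

variable [IsProbabilityMeasure m]

/-- For `u = (1 + tB)⁻¹ f` one has `-Bu = t⁻¹(u - f)`, so the Dirichlet condition reads `∫ (u - f)(u
- 1)⁺ ≤ 0`. Where `u > 1`, `f ≤ 1` gives `u - f ≥ u - 1`; hence `∫ ((u - 1)⁺)² ≤ 0`. -/
theorem DiagDirichlet.resolventOp_le_one (hD : DiagDirichlet b μ) (hμ : ∀ i, 0 < μ i) {t : ℝ}
    (ht : 0 < t) {f : Lp ℝ 2 m} (hf : ∀ᵐ x ∂m, f x ≤ 1) :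
    ∀ᵐ x ∂m, resolventOp b μ t f x ≤ 1 := by
  set u := resolventOp b μ t f with hu
  have hcoef : ∀ i, ⟪b i, t⁻¹ • (u - f)⟫_ℝ = -(μ i * ⟪b i, u⟫_ℝ) := by
    intro i
    have h0 : 1 + t * μ i ≠ 0 := by have := mul_pos ht (hμ i); positivity
    rw [inner_smul_right, inner_sub_right, hu, resolventOp,
      b.inner_diag ⟨1, abs_inv_one_add_le hμ ht.le⟩]
    field_simp
    ring
  have h1 := hD u _ hcoef
  have hp : MemLp (fun x => max (u x - 1) 0) 2 m :=
    (((Lp.memLp u).sub (memLp_const 1)).pos_part)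
  have hae : (fun x => (t⁻¹ • (u - f) : Lp ℝ 2 m) x * max (u x - 1) 0) =ᵐ[m]
      fun x => t⁻¹ * ((u x - f x) * max (u x - 1) 0) := by
    filter_upwards [Lp.coeFn_smul t⁻¹ (u - f), Lp.coeFn_sub u f] with x hx hx'
    rw [hx, Pi.smul_apply, hx', Pi.sub_apply, smul_eq_mul, mul_assoc]
  rw [integral_congr_ae hae, integral_const_mul] at h1
  have h2 : ∫ x, (u x - f x) * max (u x - 1) 0 ∂m ≤ 0 := by
    by_contra hc
    exact absurd h1 (not_le.2 (mul_pos (inv_pos.2 ht) (not_le.1 hc)))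
  have hi1 : Integrable (fun x => max (u x - 1) 0 ^ 2) m := hp.integrable_sq
  have hi2 : Integrable (fun x => (u x - f x) * max (u x - 1) 0) m :=
    ((Lp.memLp u).sub (Lp.memLp f)).integrable_mul hp
  have h3 : ∫ x, max (u x - 1) 0 ^ 2 ∂m ≤ 0 := by
    refine (integral_mono_ae hi1 hi2 ?_).trans h2
    filter_upwards [hf] with x hx
    rcases le_total (u x - 1) 0 with h | h
    · simp [max_eq_right h]
    · simp only [max_eq_left h]
      nlinarith
  have h4 := (integral_eq_zero_iff_of_nonneg (fun x => sq_nonneg _) hi1).1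
    (le_antisymm h3 (integral_nonneg fun x => sq_nonneg _))
  filter_upwards [h4] with x hx
  have : max (u x - 1) 0 = 0 := by simpa using hx
  linarith [max_eq_right_iff.1 this]

theorem DiagDirichlet.abs_resolventOp_le_one (hD : DiagDirichlet b μ) (hμ : ∀ i, 0 < μ i) {t : ℝ}
    (ht : 0 < t) {f : Lp ℝ 2 m} (hf : ∀ᵐ x ∂m, |f x| ≤ 1) :
    ∀ᵐ x ∂m, |resolventOp b μ t f x| ≤ 1 := by
  have h1 := hD.resolventOp_le_one hμ ht (hf.mono fun x hx => (abs_le.1 hx).2)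
  have h2 : ∀ᵐ x ∂m, (-f : Lp ℝ 2 m) x ≤ 1 := by
    filter_upwards [hf, Lp.coeFn_neg f] with x hx hx'
    rw [hx', Pi.neg_apply]
    linarith [(abs_le.1 hx).1]
  have h3 := hD.resolventOp_le_one hμ ht h2
  rw [map_neg] at h3
  filter_upwards [h1, h3, Lp.coeFn_neg (resolventOp b μ t f)] with x hx hx' hx''
  rw [hx'', Pi.neg_apply] at hx'
  exact abs_le.2 ⟨by linarith, hx⟩

/-- Euler's formula `exp(-tB) = lim (1 + (t/k)B)^{-k}` holds strongly on `L²`; each power of a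
resolvent keeps the bound, and an a.e. convergent subsequence carries it to the limit. -/
theorem DiagDirichlet.abs_semigroupOp_le_one (hD : DiagDirichlet b μ) (hμ : ∀ i, 0 < μ i) {t : ℝ}
    (ht : 0 < t) {f : Lp ℝ 2 m} (hf : ∀ᵐ x ∂m, |f x| ≤ 1) :
    ∀ᵐ x ∂m, |semigroupOp b μ t f x| ≤ 1 := by
  have hb : ∀ (k : ℕ) i, |((1 + t / (k + 1 : ℕ) * μ i)⁻¹) ^ (k + 1)| ≤ 1 := fun k i => by
    rw [abs_pow]
    exact pow_le_one₀ (abs_nonneg _) (abs_inv_one_add_le hμ (by positivity) i)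
  have hlim := b.tendsto_diag (φs := fun (k : ℕ) i => ((1 + t / (k + 1 : ℕ) * μ i)⁻¹) ^ (k + 1))
    (φ := fun i => Real.exp (-(t * μ i))) (K := 1) hb (abs_exp_neg_le hμ ht.le)
    (fun i => by
      have := ((Real.tendsto_one_add_div_pow_exp (t * μ i)).comp
        (Filter.tendsto_add_atTop_nat 1)).inv₀ (Real.exp_pos _).ne'
      rw [← Real.exp_neg] at this
      refine this.congr fun k => ?_
      simp only [Function.comp_apply, inv_pow]
      congr 3
      ring) f
  refine ae_abs_le_of_tendsto_L2 hlim fun k => ?_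
  have hs : 0 < t / (k + 1 : ℕ) := by positivity
  have key : ∀ j : ℕ, ∀ᵐ x ∂m,
      |b.diag (fun i => ((1 + t / (k + 1 : ℕ) * μ i)⁻¹) ^ j) f x| ≤ 1 := by
    intro j
    induction j with
    | zero =>
      have : b.diag (fun i => ((1 + t / (k + 1 : ℕ) * μ i)⁻¹) ^ 0) f = f :=
        b.ext_inner fun i => by rw [b.inner_diag ⟨1, by simp⟩]; simp
      rwa [this]
    | succ j ih =>
      have := hD.abs_resolventOp_le_one hμ hs ih
      rw [resolventOp, b.diag_diag ⟨1, abs_inv_one_add_le hμ hs.le⟩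
        ⟨1, fun i => by
          rw [abs_pow]
          exact pow_le_one₀ (abs_nonneg _) (abs_inv_one_add_le hμ hs.le i)⟩] at this
      simpa only [pow_succ'] using this
  exact key (k + 1)

theorem DiagDirichlet.integral_abs_semigroupOp_le (hD : DiagDirichlet b μ) (hμ : ∀ i, 0 < μ i)
    {t : ℝ} (ht : 0 < t) (f : Lp ℝ 2 m) :
    ∫ x, |semigroupOp b μ t f x| ∂m ≤ ∫ x, |f x| ∂m :=
  integral_abs_le_of_symm (fun f g => b.inner_diag_comm ⟨1, abs_exp_neg_le hμ ht.le⟩ f g)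
    (fun _ hg => hD.abs_semigroupOp_le_one hμ ht hg) f

end Semigroup

/-! ### The operator `L` and its powers in eigenbasis coordinates -/

section Generator

variable {F : Type*} [NormedAddCommGroup F] [InnerProductSpace ℝ F]

namespace DiscreteSpectrum

variable {ι : Type*} {L : F →ₗ.[ℝ] F} (S : DiscreteSpectrum ι L)

theorem inner_negPow (a : ℝ) (f : (S.negPow a).domain) (i : ι) :
    ⟪S.e i, S.negPow a f⟫_ℝ = S.eig i ^ a * ⟪S.e i, (f : F)⟫_ℝ := by
  rw [← S.e.repr_apply_apply]
  change S.e.repr (S.e.repr.symm _) i = _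
  rw [LinearIsometryEquiv.apply_symm_apply]

theorem mem_negPow_domain {a : ℝ} {f g : F}
    (h : ∀ i, ⟪S.e i, g⟫_ℝ = S.eig i ^ a * ⟪S.e i, f⟫_ℝ) : f ∈ (S.negPow a).domain := by
  change Memℓp (fun i => S.eig i ^ a * ⟪S.e i, f⟫_ℝ) 2
  simp only [← h]
  refine memℓp_gen ?_
  simpa using (S.e.hasSum_sq_inner g).summable

variable [CompleteSpace F]

theorem inner_apply (hL : IsSelfAdjoint L) (f : L.domain) (i : ι) :
    ⟪S.e i, L f⟫_ℝ = -(S.eig i * ⟪S.e i, (f : F)⟫_ℝ) := by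
  have h1 := L.adjoint_isFormalAdjoint hL.dense_domain
  rw [show L.adjoint = L from hL] at h1
  have h2 := h1 ⟨S.e i, S.mem_domain i⟩ f
  have h3 : L ⟨S.e i, S.mem_domain i⟩ = -(S.eig i • S.e i) := by
    rw [← S.neg_apply i, neg_neg]
  rw [h3, inner_neg_left, real_inner_smul_left] at h2
  exact h2.symm

/-- A self-adjoint operator has the largest domain its coefficients allow: by Parseval `f` lies in
the domain of the adjoint, which is `L` itself. -/
theorem exists_mem_domain (hL : IsSelfAdjoint L) {f g : F}
    (h : ∀ i, ⟪S.e i, g⟫_ℝ = S.eig i * ⟪S.e i, f⟫_ℝ) :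
    ∃ hf : f ∈ L.domain, -(L ⟨f, hf⟩) = g := by
  have hf : f ∈ L.adjoint.domain := by
    refine L.mem_adjoint_domain_of_exists f ⟨-g, fun y => ?_⟩
    rw [inner_neg_left, ← S.e.tsum_inner_mul_inner g, ← S.e.tsum_inner_mul_inner f, ← tsum_neg]
    refine tsum_congr fun i => ?_
    rw [S.inner_apply hL, real_inner_comm _ g, h i, real_inner_comm _ f]
    ring
  rw [show L.adjoint = L from hL] at hf
  refine ⟨hf, S.e.ext_inner fun i => ?_⟩
  rw [inner_neg_right, S.inner_apply hL, h i, neg_neg]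

end DiscreteSpectrum

theorem DiscreteSpectrum.diagDirichlet {E : Type*} [MeasurableSpace E] {m : Measure E}
    {ι : Type*} {L : Lp ℝ 2 m →ₗ.[ℝ] Lp ℝ 2 m} (S : DiscreteSpectrum ι L) {a : ℝ}
    (h : IsDirichletOperator (-(S.negPow a))) :
    DiagDirichlet S.e fun i => S.eig i ^ a := by
  intro u g hg
  have hu : u ∈ (S.negPow a).domain :=
    S.mem_negPow_domain (g := -g) fun i => by rw [inner_neg_right, hg i, neg_neg]
  have h1 := h.2.2 ⟨u, hu⟩
  have h2 : (-(S.negPow a)) ⟨u, hu⟩ = g := S.e.ext_inner fun i => by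
    rw [LinearPMap.neg_apply, inner_neg_right, hg i]
    exact congrArg _ (S.inner_negPow a ⟨u, hu⟩ i)
  rwa [h2] at h1

end Generator

/-- Replaces an infinite iteration: the supremum `s` satisfies `s ^ (1 + ε) ≤ D * s`, and dividing
by `s` is legitimate because `s` is finite. -/
theorem le_rpow_of_rpow_le_mul_succ {a : ℕ → ℝ} {D ε : ℝ} (hε : 0 < ε) (hD : 0 ≤ D)
    (ha : ∀ j, 0 ≤ a j) (hbdd : BddAbove (Set.range a))
    (h : ∀ j, a j ^ (1 + ε) ≤ D * a (j + 1)) (j : ℕ) : a j ≤ D ^ (1 / ε) := by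
  set s := ⨆ j, a j
  have hs : ∀ j, a j ≤ s := le_ciSup hbdd
  have hs0 : 0 ≤ s := (ha 0).trans (hs 0)
  refine (hs j).trans ?_
  rcases hs0.eq_or_lt with h0 | h0
  · rw [← h0]; positivity
  have h1 : s ≤ (D * s) ^ (1 / (1 + ε)) := by
    refine ciSup_le fun j => ?_
    rw [one_div, Real.le_rpow_inv_iff_of_pos (ha j) (by positivity) (by positivity)]
    exact (h j).trans (by gcongr; exact hs _)
  rw [one_div, Real.le_rpow_inv_iff_of_pos hs0 (by positivity) (by positivity),
    Real.rpow_add h0, Real.rpow_one, mul_comm] at h1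
  rw [one_div, Real.le_rpow_inv_iff_of_pos hs0 hD hε]
  exact le_of_mul_le_mul_right h1 h0

/-! ### Ultracontractivity from the Nash inequality -/

section Nash

variable {E : Type*} [MeasurableSpace E] {m : Measure E} {ι : Type*}

/-- The scale-invariant Nash inequality of dimension `d` for the diagonal operator with
eigenvalues `lam i`. -/
def DiagNash (b : HilbertBasis ι ℝ (Lp ℝ 2 m)) (lam : ι → ℝ) (d C : ℝ) : Prop :=
  ∀ f g : Lp ℝ 2 m, (∀ i, ⟪b i, g⟫_ℝ = lam i * ⟪b i, f⟫_ℝ) →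
    ‖f‖ ^ (2 + 4 / d) ≤ C * ⟪f, g⟫_ℝ * (∫ x, |f x| ∂m) ^ (4 / d)

variable [IsProbabilityMeasure m]

theorem eq_zero_of_integral_abs_eq_zero {f : Lp ℝ 2 m} (h : ∫ x, |f x| ∂m = 0) : f = 0 := by
  have h1 := (integral_eq_zero_iff_of_nonneg (fun x => abs_nonneg (f x)) (integrable_L2 f).abs).1 h
  rw [Lp.eq_zero_iff_ae_eq_zero]
  filter_upwards [h1] with x hx
  simpa using hx

/-- Rescaling to unit `L¹` norm makes the inequality homogeneous; `f = 0` is treated apart. -/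
theorem DiscreteSpectrum.exists_diagNash {L : Lp ℝ 2 m →ₗ.[ℝ] Lp ℝ 2 m}
    (S : DiscreteSpectrum ι L) (hL : IsSelfAdjoint L) {d : ℝ} (hd : 0 < d)
    (hN : NashInequality L d) : ∃ C, 0 < C ∧ DiagNash S.e S.eig d C := by
  obtain ⟨C, hC, h⟩ := hN
  refine ⟨C, hC, fun f g hfg => ?_⟩
  set s := ∫ x, |f x| ∂m with hs
  have hs0 : 0 ≤ s := integral_nonneg fun x => abs_nonneg _
  rcases hs0.eq_or_lt with h0 | h0
  · rw [eq_zero_of_integral_abs_eq_zero h0.symm, norm_zero, inner_zero_left,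
      Real.zero_rpow (by positivity)]
    simp
  obtain ⟨hf, rfl⟩ := S.exists_mem_domain hL hfg
  have h1 := h (s⁻¹ • ⟨f, hf⟩) (by
    have : (fun x => |((s⁻¹ • ⟨f, hf⟩ : L.domain) : Lp ℝ 2 m) x|) =ᵐ[m] fun x => s⁻¹ * |f x| := by
      filter_upwards [Lp.coeFn_smul s⁻¹ f] with x hx
      rw [Submodule.coe_smul, hx, Pi.smul_apply, smul_eq_mul, abs_mul, abs_of_pos (inv_pos.2 h0)]
    rw [integral_congr_ae this, integral_const_mul, ← hs, inv_mul_cancel₀ h0.ne'])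
  rw [LinearPMap.map_smul, Submodule.coe_smul, norm_smul, ← smul_neg, real_inner_smul_left,
    inner_smul_right, Real.norm_of_nonneg (by positivity),
    Real.mul_rpow (by positivity) (norm_nonneg _), Real.inv_rpow hs0, Real.rpow_add h0,
    Real.rpow_two] at h1
  have h2 : 0 < s ^ (4 / d) := Real.rpow_pos_of_pos h0 _
  generalize ‖f‖ ^ (2 + 4 / d) = X at h1 ⊢
  generalize s ^ (4 / d) = Y at h1 h2 ⊢
  field_simp at h1
  linarith

variable {b : HilbertBasis ι ℝ (Lp ℝ 2 m)} {μ : ι → ℝ}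

theorem pow_mul_exp_le {x t : ℝ} (hx : 0 ≤ x) (ht : 0 < t) (n : ℕ) :
    x ^ n * Real.exp (-(t * x)) ≤ n.factorial / t ^ n := by
  have h := Real.pow_div_factorial_le_exp (t * x) (by positivity) n
  rw [Real.exp_neg, ← div_eq_mul_inv, div_le_div_iff₀ (Real.exp_pos _) (by positivity)]
  rw [div_le_iff₀ (by positivity), mul_pow] at h
  linarith

theorem exists_abs_pow_mul_exp_le (hμ : ∀ i, 0 < μ i) {t : ℝ} (ht : 0 < t) (n : ℕ) :
    ∃ K, ∀ i, |μ i ^ n * Real.exp (-(t * μ i))| ≤ K := by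
  refine ⟨n.factorial / t ^ n, fun i => ?_⟩
  have := hμ i
  rw [abs_of_nonneg (by positivity)]
  exact pow_mul_exp_le (hμ i).le ht n

/-- Ultracontractivity: the semigroup of `B` maps `L¹` to `L²` if `B ^ n` satisfies a Nash
inequality. -/
theorem exists_norm_semigroupOp_le (hD : DiagDirichlet b μ) (hμ : ∀ i, 0 < μ i) {n : ℕ} {d C : ℝ}
    (hd : 0 < d) (hC : 0 < C) (hN : DiagNash b (fun i => μ i ^ n) d C) :
    ∃ C', 0 < C' ∧ ∀ t, 0 < t → ∀ f : Lp ℝ 2 m,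
      ‖semigroupOp b μ t f‖ ≤ C' * t ^ (-(n * d / 4)) * ∫ x, |f x| ∂m := by
  -- The factorial comes from `x ^ n * exp (-t x) ≤ n! / t ^ n`, the power of 2 from halving the
  -- time.
  set c : ℝ := C * n.factorial * 2 ^ (n * d / 2) with hc
  have hc0 : 0 < c := by positivity
  refine ⟨c ^ (d / 4), by positivity, fun t ht f => ?_⟩
  set M := ∫ x, |f x| ∂m with hM
  have hM0 : 0 ≤ M := integral_nonneg fun x => abs_nonneg _
  -- This weight cancels every power of `t` in the recursion between times `t` and `t / 2`.
  set K : ℝ → ℝ := fun t => t ^ (n * d / 2) * ‖semigroupOp b μ t f‖ ^ 2 with hK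
  have hstep : ∀ t, 0 < t → K t ^ (1 + 2 / d) ≤ c * M ^ (4 / d) * K (t / 2) := by
    intro t ht
    have hb1 : ∃ K, ∀ i, |Real.exp (-(t * μ i))| ≤ K := ⟨1, abs_exp_neg_le hμ ht.le⟩
    have hb2 := exists_abs_pow_mul_exp_le hμ ht n
    have h1 := hN (semigroupOp b μ t f) (b.diag (fun i => μ i ^ n * Real.exp (-(t * μ i))) f)
      (fun i => by rw [semigroupOp, b.inner_diag hb1, b.inner_diag hb2, mul_assoc])
    -- Of the two factors `exp (-t μ i)`, one absorbs `μ i ^ n`; the other is the square of the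
    -- multiplier at time `t / 2`.
    have h2 : ⟪semigroupOp b μ t f, b.diag (fun i => μ i ^ n * Real.exp (-(t * μ i))) f⟫_ℝ ≤
        n.factorial / t ^ n * ‖semigroupOp b μ (t / 2) f‖ ^ 2 := by
      refine hasSum_le (fun i => ?_) (b.hasSum_inner_diag hb1 f _)
        ((b.hasSum_norm_sq_diag ⟨1, abs_exp_neg_le hμ (half_pos ht).le⟩ f).mul_left _)
      rw [b.inner_diag hb2, ← Real.exp_nat_mul,
        show ((2 : ℕ) : ℝ) * -(t / 2 * μ i) = -(t * μ i) by push_cast; ring]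
      calc Real.exp (-(t * μ i)) *
            (⟪b i, f⟫_ℝ * (μ i ^ n * Real.exp (-(t * μ i)) * ⟪b i, f⟫_ℝ))
          = (μ i ^ n * Real.exp (-(t * μ i))) * (Real.exp (-(t * μ i)) * ⟪b i, f⟫_ℝ ^ 2) := by
            ring
        _ ≤ _ := by
            gcongr
            exact pow_mul_exp_le (hμ i).le ht n
    have h3 : (∫ x, |semigroupOp b μ t f x| ∂m) ^ (4 / d) ≤ M ^ (4 / d) :=
      Real.rpow_le_rpow (integral_nonneg fun x => abs_nonneg _)
        (hD.integral_abs_semigroupOp_le hμ ht f) (by positivity)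
    have h4 : ‖semigroupOp b μ t f‖ ^ (2 + 4 / d) ≤
        C * (n.factorial / t ^ n * ‖semigroupOp b μ (t / 2) f‖ ^ 2) * M ^ (4 / d) := by
      refine h1.trans (mul_le_mul (by gcongr) h3 (Real.rpow_nonneg
        (integral_nonneg fun x => abs_nonneg _) _) (by positivity))
    have e1 : K t ^ (1 + 2 / d) =
        t ^ (n * d / 2) * t ^ n * ‖semigroupOp b μ t f‖ ^ (2 + 4 / d) := by
      rw [hK, Real.mul_rpow (by positivity) (by positivity), ← Real.rpow_mul ht.le,
        ← Real.rpow_natCast _ 2, ← Real.rpow_mul (norm_nonneg _), ← Real.rpow_natCast t n,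
        ← Real.rpow_add ht]
      congr 2
      · field_simp
      · push_cast; field_simp; ring
    have e2 : t ^ ((n : ℝ) * d / 2) = 2 ^ ((n : ℝ) * d / 2) * (t / 2) ^ ((n : ℝ) * d / 2) := by
      rw [← Real.mul_rpow (by norm_num) (by positivity)]
      congr 1; ring
    calc K t ^ (1 + 2 / d) ≤ t ^ (n * d / 2) * t ^ n *
          (C * (n.factorial / t ^ n * ‖semigroupOp b μ (t / 2) f‖ ^ 2) * M ^ (4 / d)) := by
          rw [e1]; gcongr
      _ = c * M ^ (4 / d) * K (t / 2) := by
          simp only [hK, hc]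
          rw [e2]
          field_simp
  -- The recursion runs along the times `t / 2 ^ j`; the `L²` contraction supplies the required a
  -- priori bound.
  have hKt : K t ≤ (c * M ^ (4 / d)) ^ (1 / (2 / d)) := by
    have := le_rpow_of_rpow_le_mul_succ (a := fun j => K (t / 2 ^ j)) (ε := 2 / d)
      (D := c * M ^ (4 / d)) (by positivity) (by positivity) (fun j => by positivity)
      ⟨t ^ (n * d / 2) * ‖f‖ ^ 2, ?_⟩ (fun j => ?_) 0
    · simpa using this
    · rintro _ ⟨j, rfl⟩
      have hj : t / 2 ^ j ≤ t := div_le_self ht.le (one_le_pow₀ (by norm_num))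
      have hn := b.norm_diag_le zero_le_one (abs_exp_neg_le hμ (t := t / 2 ^ j) (by positivity)) f
      rw [one_mul] at hn
      simp only [hK]
      gcongr
      exact hn
    · have := hstep (t / 2 ^ j) (by positivity)
      rwa [div_div, ← pow_succ] at this
  have e3 : (c * M ^ (4 / d)) ^ (1 / (2 / d)) = (c ^ (d / 4) * M) ^ 2 := by
    rw [Real.mul_rpow hc0.le (by positivity), ← Real.rpow_mul hM0, mul_pow,
      ← Real.rpow_natCast (c ^ (d / 4)) 2, ← Real.rpow_mul hc0.le,
      show 4 / d * (1 / (2 / d)) = ((2 : ℕ) : ℝ) by push_cast; field_simp; norm_num,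
      Real.rpow_natCast, show d / 4 * ((2 : ℕ) : ℝ) = 1 / (2 / d) by push_cast; field_simp; norm_num]
  rw [e3] at hKt
  have e5 : K t = (t ^ ((n : ℝ) * d / 4) * ‖semigroupOp b μ t f‖) ^ 2 := by
    simp only [hK]
    rw [mul_pow, ← Real.rpow_natCast (t ^ _) 2, ← Real.rpow_mul ht.le]
    congr 2
    push_cast; ring
  rw [e5, sq_le_sq₀ (by positivity) (by positivity)] at hKt
  rw [Real.rpow_neg ht.le]
  have : 0 < t ^ ((n : ℝ) * d / 4) := Real.rpow_pos_of_pos ht _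
  rwa [mul_right_comm, ← div_eq_mul_inv, le_div_iff₀' this]

end Nash

/-! ### Interpolation by truncation -/

section Interpolation

variable {E : Type*} [MeasurableSpace E] {m : Measure E}

theorem integrable_abs_rpow {p : ℝ} (hp0 : 0 < p) {f : E → ℝ}
    (hf : MemLp f (ENNReal.ofReal p) m) : Integrable (fun x => |f x| ^ p) m := by
  have := hf.integrable_norm_rpow (by simpa using hp0) ENNReal.ofReal_ne_top
  simpa [ENNReal.toReal_ofReal hp0.le] using this

theorem eLpNorm_ofReal_toReal {p : ℝ} (hp0 : 0 < p) {f : E → ℝ}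
    (hf : MemLp f (ENNReal.ofReal p) m) :
    (eLpNorm f (ENNReal.ofReal p) m).toReal = (∫ x, |f x| ^ p ∂m) ^ (1 / p) := by
  rw [hf.eLpNorm_eq_integral_rpow_norm (by simpa using hp0) ENNReal.ofReal_ne_top,
    ENNReal.toReal_ofReal hp0.le, ENNReal.toReal_ofReal (by positivity), one_div]
  simp only [Real.norm_eq_abs]

variable [IsProbabilityMeasure m]

theorem memLp_ofReal_of_L2 {p : ℝ} (hp : p ≤ 2) (f : Lp ℝ 2 m) :
    MemLp f (ENNReal.ofReal p) m :=
  (Lp.memLp f).mono_exponent (by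
    rw [← ENNReal.ofReal_ofNat]; exact ENNReal.ofReal_le_ofReal hp)

/-- Splitting an `L²` function at the level `s`, with an `L¹` bound on the large part and an
`L²` bound on the small part. -/
theorem exists_truncation {p : ℝ} (hp1 : 1 ≤ p) (hp2 : p ≤ 2) (f : Lp ℝ 2 m) {s : ℝ}
    (hs : 0 < s) : ∃ f₁ f₂ : Lp ℝ 2 m, f = f₁ + f₂ ∧
      ∫ x, |f₁ x| ∂m ≤ s ^ (1 - p) * ∫ x, |f x| ^ p ∂m ∧
      ‖f₂‖ ^ 2 ≤ s ^ (2 - p) * ∫ x, |f x| ^ p ∂m := by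
  have hA : MeasurableSet {x | s < |f x|} :=
    measurableSet_lt measurable_const (Lp.stronglyMeasurable f).measurable.abs
  have hg : MemLp (Set.indicator {x | s < |f x|} f) 2 m := (Lp.memLp f).indicator hA
  have hi := integrable_abs_rpow (by linarith) (memLp_ofReal_of_L2 hp2 f)
  refine ⟨hg.toLp, f - hg.toLp, by abel, ?_, ?_⟩
  · rw [← integral_const_mul]
    refine integral_mono_ae (integrable_L2 _).abs (hi.const_mul _) ?_
    filter_upwards [hg.coeFn_toLp] with x hx
    simp only [hx]
    by_cases h : s < |f x|
    · rw [Set.indicator_of_mem (by exact h)]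
      have h0 : 0 < |f x| := hs.trans h
      have h1 : |f x| ^ (1 - p) ≤ s ^ (1 - p) :=
        Real.rpow_le_rpow_of_nonpos hs h.le (by linarith)
      calc |f x| = |f x| ^ (1 - p) * |f x| ^ p := by
            rw [← Real.rpow_add h0, sub_add_cancel, Real.rpow_one]
        _ ≤ _ := by gcongr
    · rw [Set.indicator_of_notMem (by exact h), abs_zero]
      positivity
  · rw [← real_inner_self_eq_norm_sq, inner_L2_eq_integral, ← integral_const_mul]
    refine integral_mono_ae (integrable_mul_L2 _ _) (hi.const_mul _) ?_
    filter_upwards [hg.coeFn_toLp, Lp.coeFn_sub f hg.toLp] with x hx hx'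
    simp only [hx', Pi.sub_apply, hx]
    by_cases h : s < |f x|
    · rw [Set.indicator_of_mem (by exact h), sub_self, zero_mul]
      positivity
    · rw [Set.indicator_of_notMem (by exact h), sub_zero, ← abs_mul_abs_self]
      rcases (abs_nonneg (f x)).eq_or_lt with h0 | h0
      · rw [← h0]; simp only [mul_zero]; positivity
      have h1 : |f x| ^ (2 - p) ≤ s ^ (2 - p) :=
        Real.rpow_le_rpow h0.le (not_lt.1 h) (by linarith)
      calc |f x| * |f x| = |f x| ^ (2 - p) * |f x| ^ p := by
            rw [← Real.rpow_add h0, sub_add_cancel, Real.rpow_two, sq]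
        _ ≤ _ := by gcongr

theorem eq_zero_of_integral_rpow_eq_zero {p : ℝ} (hp1 : 1 ≤ p) (hp2 : p ≤ 2) {f : Lp ℝ 2 m}
    (h : ∫ x, |f x| ^ p ∂m = 0) : f = 0 := by
  have h1 := (integral_eq_zero_iff_of_nonneg (fun x => by positivity)
    (integrable_abs_rpow (by linarith) (memLp_ofReal_of_L2 hp2 f))).1 h
  rw [Lp.eq_zero_iff_ae_eq_zero]
  filter_upwards [h1] with x hx
  simpa using ((Real.rpow_eq_zero_iff_of_nonneg (abs_nonneg _)).1 hx).1

/-- Interpolation between a bound `L¹ → L²` with constant `A` and the contractivity on `L²`. -/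
theorem norm_le_of_L1_bound {p : ℝ} (hp1 : 1 ≤ p) (hp2 : p ≤ 2) {T : Lp ℝ 2 m →ₗ[ℝ] Lp ℝ 2 m}
    {c A : ℝ} (hc : 0 ≤ c) (hA : 0 < A) (h1 : ∀ f : Lp ℝ 2 m, ‖T f‖ ≤ c * A * ∫ x, |f x| ∂m)
    (h2 : ∀ f, ‖T f‖ ≤ ‖f‖) (f : Lp ℝ 2 m) :
    ‖T f‖ ≤ (c + 1) * A ^ (2 / p - 1) * (eLpNorm f (ENNReal.ofReal p) m).toReal := by
  have hp0 : 0 < p := by linarith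
  rw [eLpNorm_ofReal_toReal hp0 (memLp_ofReal_of_L2 hp2 f)]
  set I := ∫ x, |f x| ^ p ∂m with hI
  have hI0 : 0 ≤ I := integral_nonneg fun x => by positivity
  rcases hI0.eq_or_lt with h0 | h0
  · rw [eq_zero_of_integral_rpow_eq_zero hp1 hp2 h0.symm, map_zero, norm_zero]
    positivity
  set J := I ^ (1 / p) with hJ
  have hJ0 : 0 < J := by positivity
  have hIJ : I = J ^ p := by
    rw [hJ, ← Real.rpow_mul hI0, one_div_mul_cancel hp0.ne', Real.rpow_one]
  -- The level at which the two pieces balance: both are then mapped to norms of order `s / A`.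
  set s := J * A ^ (2 / p) with hs
  have hs0 : 0 < s := by positivity
  obtain ⟨f₁, f₂, hf, hf₁, hf₂⟩ := exists_truncation hp1 hp2 f hs0
  have hsp : s ^ p = J ^ p * A ^ 2 := by
    rw [hs, Real.mul_rpow hJ0.le (by positivity), ← Real.rpow_mul hA.le,
      div_mul_cancel₀ _ hp0.ne', Real.rpow_two]
  have e1 : s ^ (1 - p) * I = s / A ^ 2 := by
    rw [Real.rpow_sub hs0, Real.rpow_one, hsp, hIJ]
    field_simp
  have e2 : s ^ (2 - p) * I = (s / A) ^ 2 := by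
    rw [Real.rpow_sub hs0, Real.rpow_two, hsp, hIJ]
    field_simp
  have e3 : A ^ (2 / p - 1) * J = s / A := by
    rw [Real.rpow_sub hA, Real.rpow_one, hs]
    ring
  rw [← hI, e1] at hf₁
  rw [← hI, e2, sq_le_sq₀ (norm_nonneg _) (by positivity)] at hf₂
  calc ‖T f‖ = ‖T f₁ + T f₂‖ := by rw [← map_add, ← hf]
    _ ≤ ‖T f₁‖ + ‖T f₂‖ := norm_add_le _ _
    _ ≤ c * A * (s / A ^ 2) + s / A := by
        refine add_le_add ((h1 f₁).trans ?_) ((h2 f₂).trans hf₂)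
        gcongr
    _ = (c + 1) * (s / A) := by field_simp
    _ = _ := by rw [← e3]; ring

end Interpolation

/-! ### Dyadic summation of the spectral tail -/

section Tail

variable {E : Type*} [MeasurableSpace E] {m : Measure E} [IsProbabilityMeasure m]
  {ι : Type*} {b : HilbertBasis ι ℝ (Lp ℝ 2 m)} {μ : ι → ℝ}

/-- The spectral tail of the form `⟨f, B⁻ⁿ f⟩` is small relative to the `Lᵖ` norm. -/
theorem exists_tail_bound (hD : DiagDirichlet b μ) {a : ℝ} (ha : 0 < a) (hμ : ∀ i, a ≤ μ i)
    {n : ℕ} (hn : 1 ≤ n) {d C : ℝ} (hd : 0 < d) (hC : 0 < C)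
    (hN : DiagNash b (fun i => μ i ^ n) d C) {p : ℝ} (hp1 : 1 ≤ p) (hp2 : p ≤ 2)
    (hdp : d * (2 / p - 1) < 2) :
    ∃ K ρ : ℝ, 0 ≤ K ∧ 0 ≤ ρ ∧ ρ < 1 ∧ ∀ (N : ℕ) (f : Lp ℝ 2 m) (s : Finset ι),
      (∀ i ∈ s, a * 2 ^ N ≤ μ i) → ∑ i ∈ s, (μ i ^ n)⁻¹ * ⟪b i, f⟫_ℝ ^ 2 ≤
        K * ρ ^ N * (eLpNorm f (ENNReal.ofReal p) m).toReal ^ 2 := by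
  have hμ0 : ∀ i, 0 < μ i := fun i => ha.trans_le (hμ i)
  obtain ⟨c, hc, hT⟩ := exists_norm_semigroupOp_le hD hμ0 hd hC hN
  set α : ℝ := n * d / 4 * (2 / p - 1) with hα
  -- With `t = 2^{-k}`, each shell gains `t ^ n` from `(μ i ^ n)⁻¹` and loses `t ^ (-2α)` to the
  -- smoothing estimate; `hdp` makes the balance favourable.
  set ρ : ℝ := 2 ^ (2 * α - n) with hρ
  have hρ0 : 0 < ρ := by positivity
  have hn0 : (0 : ℝ) < n := by exact_mod_cast hn
  have hρ1 : ρ < 1 := by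
    refine Real.rpow_lt_one_of_one_lt_of_neg (by norm_num) ?_
    have : 2 * α = n * (d * (2 / p - 1)) / 2 := by rw [hα]; ring
    rw [this]
    nlinarith
  set K₀ : ℝ := (a ^ n)⁻¹ * Real.exp (4 * a) * (c + 1) ^ 2 with hK₀
  refine ⟨K₀ / (1 - ρ), ρ, by have := sub_pos.2 hρ1; positivity, hρ0.le, hρ1, fun N f s hs => ?_⟩
  set X := (eLpNorm f (ENNReal.ofReal p) m).toReal with hX
  have hnear : ∀ i, ∃ k : ℕ, a * 2 ^ k ≤ μ i ∧ μ i < a * 2 ^ (k + 1) := fun i => by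
    obtain ⟨k, hk1, hk2⟩ := exists_nat_pow_near (x := μ i / a) (y := 2)
      ((one_le_div ha).2 (hμ i)) (by norm_num)
    exact ⟨k, by rwa [le_div_iff₀' ha] at hk1, by rwa [div_lt_iff₀' ha] at hk2⟩
  choose κ hκ1 hκ2 using hnear
  have hκN : ∀ i ∈ s, N ≤ κ i := fun i hi => by
    have h1 : a * 2 ^ N < a * 2 ^ (κ i + 1) := (hs i hi).trans_lt (hκ2 i)
    have h2 := (pow_lt_pow_iff_right₀ (by norm_num : (1 : ℝ) < 2)).1 (lt_of_mul_lt_mul_left h1 ha.le)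
    omega
  have hshell : ∀ k : ℕ, ∀ s' : Finset ι, (∀ i ∈ s', κ i = k) →
      ∑ i ∈ s', (μ i ^ n)⁻¹ * ⟪b i, f⟫_ℝ ^ 2 ≤ K₀ * X ^ 2 * ρ ^ k := by
    intro k s' hs'
    -- On this shell `a ≤ t * μ i < 2 * a`, so inserting `exp (-(t * μ i)) ^ 2` costs at most `exp
    -- (4 * a)`.
    set t : ℝ := (2 ^ k)⁻¹ with ht
    have ht0 : 0 < t := by positivity
    have hTt : ‖semigroupOp b μ t f‖ ≤ (c + 1) * t ^ (-α) * X := by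
      have h1 := norm_le_of_L1_bound hp1 hp2 (T := semigroupOp b μ t) (c := c)
        (A := t ^ (-(n * d / 4))) hc.le (by positivity) (hT t ht0)
        (fun f => by
          exact (b.norm_diag_le zero_le_one (abs_exp_neg_le hμ0 ht0.le) f).trans_eq (one_mul _)) f
      rwa [← Real.rpow_mul ht0.le, show -(n * d / 4) * (2 / p - 1) = -α by rw [hα]; ring] at h1
    have hterm : ∀ i ∈ s', (μ i ^ n)⁻¹ * ⟪b i, f⟫_ℝ ^ 2 ≤
        (a ^ n)⁻¹ * t ^ n * Real.exp (4 * a) *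
          (Real.exp (-(t * μ i)) ^ 2 * ⟪b i, f⟫_ℝ ^ 2) := by
      intro i hi
      have h1 := hκ1 i
      have h2 := hκ2 i
      rw [hs' i hi] at h1 h2
      have h3 : (μ i ^ n)⁻¹ ≤ (a ^ n)⁻¹ * t ^ n := by
        rw [ht, inv_pow, ← mul_inv, ← mul_pow]
        gcongr
      have h4 : 1 ≤ Real.exp (4 * a) * Real.exp (-(t * μ i)) ^ 2 := by
        rw [← Real.exp_nat_mul, ← Real.exp_add, Real.one_le_exp_iff]
        have h5 : t * μ i ≤ 2 * a := by
          rw [ht, inv_mul_le_iff₀ (by positivity)]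
          rw [pow_succ] at h2
          linarith
        push_cast
        linarith
      calc (μ i ^ n)⁻¹ * ⟪b i, f⟫_ℝ ^ 2
          ≤ ((a ^ n)⁻¹ * t ^ n) * ⟪b i, f⟫_ℝ ^ 2 := by gcongr
        _ ≤ ((a ^ n)⁻¹ * t ^ n) * ⟪b i, f⟫_ℝ ^ 2 *
              (Real.exp (4 * a) * Real.exp (-(t * μ i)) ^ 2) :=
            le_mul_of_one_le_right (by positivity) h4
        _ = _ := by ring
    have hρk : ρ ^ k = t ^ n * (t ^ (-α)) ^ 2 := by
      rw [hρ, ht, ← Real.rpow_natCast, ← Real.rpow_natCast, ← Real.rpow_natCast,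
        ← Real.rpow_natCast, ← Real.rpow_neg (by norm_num), ← Real.rpow_mul (by norm_num),
        ← Real.rpow_mul (by norm_num), ← Real.rpow_mul (by norm_num),
        ← Real.rpow_mul (by norm_num), ← Real.rpow_add (by norm_num)]
      congr 1
      push_cast; ring
    calc ∑ i ∈ s', (μ i ^ n)⁻¹ * ⟪b i, f⟫_ℝ ^ 2
        ≤ ∑ i ∈ s', (a ^ n)⁻¹ * t ^ n * Real.exp (4 * a) *
          (Real.exp (-(t * μ i)) ^ 2 * ⟪b i, f⟫_ℝ ^ 2) := Finset.sum_le_sum hterm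
      _ = (a ^ n)⁻¹ * t ^ n * Real.exp (4 * a) *
          ∑ i ∈ s', Real.exp (-(t * μ i)) ^ 2 * ⟪b i, f⟫_ℝ ^ 2 := by rw [Finset.mul_sum]
      _ ≤ (a ^ n)⁻¹ * t ^ n * Real.exp (4 * a) * ‖semigroupOp b μ t f‖ ^ 2 := by
          gcongr
          exact sum_le_hasSum s' (fun i _ => by positivity)
            (b.hasSum_norm_sq_diag ⟨1, abs_exp_neg_le hμ0 ht0.le⟩ f)
      _ ≤ (a ^ n)⁻¹ * t ^ n * Real.exp (4 * a) * ((c + 1) * t ^ (-α) * X) ^ 2 := by gcongr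
      _ = K₀ * X ^ 2 * ρ ^ k := by rw [hρk, hK₀]; ring
  classical
  -- Shells are indexed by `κ i - N`, which pulls `ρ ^ N` out of the geometric series; the truncated
  -- subtraction is harmless by `hκN`.
  have hmaps : ∀ i ∈ s, κ i - N ∈ s.image fun i => κ i - N :=
    fun i hi => Finset.mem_image_of_mem _ hi
  calc ∑ i ∈ s, (μ i ^ n)⁻¹ * ⟪b i, f⟫_ℝ ^ 2
      = ∑ j ∈ s.image (fun i => κ i - N),
          ∑ i ∈ s with κ i - N = j, (μ i ^ n)⁻¹ * ⟪b i, f⟫_ℝ ^ 2 :=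
        (Finset.sum_fiberwise_of_maps_to hmaps _).symm
    _ ≤ ∑ j ∈ s.image (fun i => κ i - N), K₀ * X ^ 2 * ρ ^ N * ρ ^ j := by
        refine Finset.sum_le_sum fun j _ => ?_
        have := hshell (N + j) (s.filter fun i => κ i - N = j) fun i hi => by
          have h1 := Finset.mem_filter.1 hi
          have h2 := hκN i h1.1
          omega
        rwa [pow_add, ← mul_assoc] at this
    _ ≤ K₀ * X ^ 2 * ρ ^ N * (1 - ρ)⁻¹ := by
        rw [← Finset.mul_sum]
        gcongr
        exact sum_le_hasSum _ (fun _ _ => by positivity)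
          (hasSum_geometric_of_lt_one hρ0.le hρ1)
    _ = K₀ / (1 - ρ) * ρ ^ N * X ^ 2 := by ring

end Tail

/-! ### Inclusions between Lebesgue spaces -/

section Inclusion

variable {E : Type*} [MeasurableSpace E] {m : Measure E} [IsFiniteMeasure m]

/-- The inclusion `L^q ⊂ L^p` for `p ≤ q` on a finite measure space. -/
def lpInclusion {p q : ℝ≥0∞} (h : p ≤ q) : Lp ℝ q m →ₗ[ℝ] Lp ℝ p m where
  toFun f := ((Lp.memLp f).mono_exponent h).toLp f
  map_add' f g := by
    rw [← MemLp.toLp_add]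
    exact MemLp.toLp_congr _ _ (Lp.coeFn_add f g)
  map_smul' c f := by
    rw [RingHom.id_apply, ← MemLp.toLp_const_smul]
    exact MemLp.toLp_congr _ _ (Lp.coeFn_smul c f)

theorem coeFn_lpInclusion {p q : ℝ≥0∞} (h : p ≤ q) (f : Lp ℝ q m) : lpInclusion h f =ᵐ[m] f :=
  ((Lp.memLp f).mono_exponent h).coeFn_toLp

theorem norm_lpInclusion {p q : ℝ≥0∞} (h : p ≤ q) (f : Lp ℝ q m) :
    ‖lpInclusion h f‖ = (eLpNorm f p m).toReal := by
  rw [Lp.norm_def, eLpNorm_congr_ae (coeFn_lpInclusion h f)]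

/-- Simple functions are dense in `L^p` and, the measure being finite, belong to `L^q`. -/
theorem denseRange_lpInclusion {p q : ℝ≥0∞} [Fact (1 ≤ p)] (hp : p ≠ ∞) (h : p ≤ q) :
    DenseRange (lpInclusion h : Lp ℝ q m →ₗ[ℝ] Lp ℝ p m) := by
  refine (Lp.simpleFunc.dense (E := ℝ) (μ := m) hp).mono ?_
  intro f hf
  set g := Lp.simpleFunc.toSimpleFunc (⟨f, hf⟩ : Lp.simpleFunc ℝ p m)
  have hg : g =ᵐ[m] f := Lp.simpleFunc.toSimpleFunc_eq_toFun ⟨f, hf⟩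
  refine ⟨(SimpleFunc.memLp_of_isFiniteMeasure g q m).toLp g, Lp.ext ?_⟩
  exact (coeFn_lpInclusion h _).trans ((MemLp.coeFn_toLp _).trans hg)

end Inclusion

/-! ### Converse Hölder inequality -/

section ConverseHolder

variable {E : Type*} [MeasurableSpace E] {m : Measure E} [IsProbabilityMeasure m]

/-- Tests against `y = sign g * min(|g|, N) ^ (q - 1)`. With `I` the integral of the truncation to
the power `q`, this gives `I ≤ B * I ^ (1 / p)`; truncating keeps `y` in `L²` and `I` finite, so one
may divide. -/
theorem eLpNorm_truncation_le {p q : ℝ} (hpq : p.HolderConjugate q) {g : Lp ℝ 2 m} {B : ℝ}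
    (hB : 0 ≤ B)
    (h : ∀ y : Lp ℝ 2 m, ⟪g, y⟫_ℝ ≤ B * (eLpNorm y (ENNReal.ofReal p) m).toReal) (N : ℕ) :
    eLpNorm (fun x => min |g x| N) (ENNReal.ofReal q) m ≤ ENNReal.ofReal B := by
  have hp0 : 0 < p := hpq.pos
  have hq0 : 0 < q := hpq.symm.pos
  have hgm : Measurable g := (Lp.stronglyMeasurable g).measurable
  have hmin0 : ∀ x, 0 ≤ min |g x| (N : ℝ) := fun x => le_min (abs_nonneg _) (Nat.cast_nonneg _)
  have htm : Measurable fun x => min |g x| (N : ℝ) := hgm.abs.min measurable_const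
  have htL : ∀ P : ℝ≥0∞, MemLp (fun x => min |g x| (N : ℝ)) P m := fun P =>
    MemLp.of_bound htm.aestronglyMeasurable N (Filter.Eventually.of_forall fun x => by
      rw [Real.norm_of_nonneg (hmin0 x)]; exact min_le_right _ _)
  set I := ∫ x, min |g x| (N : ℝ) ^ q ∂m with hI
  have hI0 : 0 ≤ I := integral_nonneg fun x => Real.rpow_nonneg (hmin0 x) _
  set σ : E → ℝ := fun x => if 0 ≤ g x then 1 else -1 with hσ
  have hσm : Measurable σ :=
    Measurable.ite (measurableSet_le measurable_const hgm) measurable_const measurable_const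
  have hσ1 : ∀ x, |σ x| = 1 := fun x => by simp only [hσ]; split_ifs <;> simp
  have hσg : ∀ x, g x * σ x = |g x| := fun x => by
    simp only [hσ]
    split_ifs with hx
    · rw [abs_of_nonneg hx, mul_one]
    · rw [abs_of_neg (not_le.1 hx)]; ring
  set y : E → ℝ := fun x => min |g x| (N : ℝ) ^ (q - 1) * σ x with hy
  have hyabs : ∀ x, |y x| = min |g x| (N : ℝ) ^ (q - 1) := fun x => by
    simp only [hy]
    rw [abs_mul, hσ1, mul_one, abs_of_nonneg (Real.rpow_nonneg (hmin0 x) _)]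
  have hq1 : 0 < q - 1 := sub_pos.2 hpq.symm.lt
  have hyL : ∀ P : ℝ≥0∞, MemLp y P m := fun P =>
    MemLp.of_bound ((htm.pow_const _).mul hσm).aestronglyMeasurable ((N : ℝ) ^ (q - 1))
      (Filter.Eventually.of_forall fun x => by
        rw [Real.norm_eq_abs, hyabs]
        exact Real.rpow_le_rpow (hmin0 x) (min_le_right _ _) hq1.le)
  have hynorm : (eLpNorm ((hyL 2).toLp y) (ENNReal.ofReal p) m).toReal = I ^ (1 / p) := by
    rw [eLpNorm_congr_ae (hyL 2).coeFn_toLp, eLpNorm_ofReal_toReal hp0 (hyL _), hI]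
    congr 1
    refine integral_congr_ae (Filter.Eventually.of_forall fun x => ?_)
    simp only [hyabs]
    rw [← Real.rpow_mul (hmin0 x), hpq.symm.sub_one_mul_conj]
  have hIle : I ≤ ⟪g, (hyL 2).toLp y⟫_ℝ := by
    rw [inner_L2_eq_integral, hI]
    refine integral_mono_ae ?_ (integrable_mul_L2 _ _) ?_
    · have := integrable_abs_rpow hq0 (htL (ENNReal.ofReal q))
      refine this.congr (Filter.Eventually.of_forall fun x => ?_)
      simp only [abs_of_nonneg (hmin0 x)]
    · filter_upwards [(hyL 2).coeFn_toLp] with x hx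
      rw [hx]
      simp only [hy]
      rw [mul_left_comm, hσg]
      rcases (hmin0 x).eq_or_lt with h0 | h0
      · rw [← h0, Real.zero_rpow hq0.ne', Real.zero_rpow hq1.ne', zero_mul]
      · calc min |g x| (N : ℝ) ^ q = min |g x| (N : ℝ) ^ (q - 1) * min |g x| (N : ℝ) := by
              rw [← Real.rpow_add_one h0.ne', sub_add_cancel]
          _ ≤ _ := by
              gcongr
              exact min_le_left _ _
  have hkey : I ≤ B * I ^ (1 / p) := hynorm ▸ hIle.trans (h _)
  have hIB : I ^ (1 / q) ≤ B := by
    rcases hI0.eq_or_lt with h0 | h0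
    · rw [← h0, Real.zero_rpow (by positivity)]; exact hB
    · have h1 : I ^ (1 / q) * I ^ (1 / p) = I := by
        rw [← Real.rpow_add h0, one_div, one_div, add_comm, hpq.inv_add_inv_eq_one, Real.rpow_one]
      have h2 : I ^ (1 / q) * I ^ (1 / p) ≤ B * I ^ (1 / p) := h1.trans_le hkey
      exact le_of_mul_le_mul_right h2 (by positivity)
  rw [← ENNReal.ofReal_toReal (htL (ENNReal.ofReal q)).eLpNorm_ne_top,
    eLpNorm_ofReal_toReal hq0 (htL _)]
  refine ENNReal.ofReal_le_ofReal (le_trans (le_of_eq ?_) hIB)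
  simp only [abs_of_nonneg (hmin0 _), hI]

/-- Converse of Hölder's inequality, testing against `L²` functions. -/
theorem eLpNorm_le_of_inner_le {p q : ℝ} (hpq : p.HolderConjugate q) {g : Lp ℝ 2 m} {B : ℝ}
    (hB : 0 ≤ B)
    (h : ∀ y : Lp ℝ 2 m, ⟪g, y⟫_ℝ ≤ B * (eLpNorm y (ENNReal.ofReal p) m).toReal) :
    eLpNorm g (ENNReal.ofReal q) m ≤ ENNReal.ofReal B := by
  have hgm : Measurable g := (Lp.stronglyMeasurable g).measurable
  -- Fatou's lemma as the truncation level tends to infinity.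
  have h1 : eLpNorm (fun x => |g x|) (ENNReal.ofReal q) m ≤ ENNReal.ofReal B := by
    refine (Lp.eLpNorm_lim_le_liminf_eLpNorm (f := fun (N : ℕ) x => min |g x| (N : ℝ))
      (fun N => (hgm.abs.min measurable_const).aestronglyMeasurable) _
      (Filter.Eventually.of_forall fun x => ?_)).trans ?_
    · refine tendsto_const_nhds.congr' ?_
      filter_upwards [Filter.eventually_ge_atTop ⌈|g x|⌉₊] with N hN
      exact (min_eq_left ((Nat.le_ceil _).trans (by exact_mod_cast hN))).symm
    · exact Filter.liminf_le_of_frequently_le'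
        (Filter.Frequently.of_forall fun N => eLpNorm_truncation_le hpq hB h N)
  rwa [← eLpNorm_norm]

end ConverseHolder

/-- A limit of compact operators in operator norm is compact. -/
theorem isCompactOperator_of_norm_sub_le {X Y : Type*} [NormedAddCommGroup X] [NormedSpace ℝ X]
    [NormedAddCommGroup Y] [NormedSpace ℝ Y] [CompleteSpace Y] {J : X →L[ℝ] Y}
    {T : ℕ → X →L[ℝ] Y} {c : ℕ → ℝ} (hc : ∀ N, 0 ≤ c N)
    (hc0 : Filter.Tendsto c Filter.atTop (nhds 0)) (hT : ∀ N, IsCompactOperator (T N))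
    (h : ∀ N x, ‖J x - T N x‖ ≤ c N * ‖x‖) : IsCompactOperator J := by
  have hlim : Filter.Tendsto T Filter.atTop (nhds J) := by
    rw [tendsto_iff_norm_sub_tendsto_zero]
    refine squeeze_zero (fun N => norm_nonneg _) (fun N => ?_) hc0
    rw [norm_sub_rev]
    exact ContinuousLinearMap.opNorm_le_bound _ (hc N) (h N)
  exact isCompactOperator_of_tendsto hlim (Filter.Eventually.of_forall hT)

/-! ### The space `H`, spectral projections and the inverse of `-L` -/

namespace DiscreteSpectrum

section Abstract

variable {F : Type*} [NormedAddCommGroup F] [InnerProductSpace ℝ F]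
  {ι : Type*} {L : F →ₗ.[ℝ] F} (S : DiscreteSpectrum ι L)

/-- The canonical inclusion into `H` as a linear map. -/
def toHₗ : F →ₗ[ℝ] S.H :=
  (UniformSpace.Completion.toComplₗᵢ (𝕜 := ℝ) (E := S.PreH)).toLinearMap ∘ₗ S.toPreH.toLinearMap

theorem toHₗ_apply (x : F) : S.toHₗ x = S.toH x := rfl

theorem exists_abs_inv_eig_le : ∃ K, ∀ i, |(S.eig i)⁻¹| ≤ K := by
  obtain ⟨K, hK⟩ := S.exists_inv_eig_le
  refine ⟨K, fun i => ?_⟩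
  rw [abs_of_pos (inv_pos.2 (S.eig_pos i)), ← one_div]
  exact hK i

/-- The bounded inverse of `-L`. -/
def negInv : F →ₗ[ℝ] F := S.e.diag fun i => (S.eig i)⁻¹

theorem inner_negInv (f : F) (i : ι) : ⟪S.e i, S.negInv f⟫_ℝ = (S.eig i)⁻¹ * ⟪S.e i, f⟫_ℝ :=
  S.e.inner_diag S.exists_abs_inv_eig_le f i

theorem inner_toH (x y : F) : ⟪S.toH x, S.toH y⟫_ℝ = ⟪S.negInv x, y⟫_ℝ := by
  have h1 : ⟪S.toH x, S.toH y⟫_ℝ = S.innerH x y :=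
    UniformSpace.Completion.inner_coe (𝕜 := ℝ) (E := S.PreH) _ _
  rw [h1, negInv, ← (S.e.hasSum_inner_diag S.exists_abs_inv_eig_le x y).tsum_eq, innerH]
  refine tsum_congr fun i => ?_
  rw [one_div, real_inner_comm _ x, real_inner_comm _ y]

theorem hasSum_norm_toH_sq (x : F) :
    HasSum (fun i => (S.eig i)⁻¹ * ⟪S.e i, x⟫_ℝ ^ 2) (‖S.toH x‖ ^ 2) := by
  rw [← real_inner_self_eq_norm_sq, inner_toH]
  simpa only [sq, negInv] using S.e.hasSum_inner_diag S.exists_abs_inv_eig_le x x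

theorem inner_toH_e (i : ι) (x : F) :
    ⟪S.toH (S.e i), S.toH x⟫_ℝ = (S.eig i)⁻¹ * ⟪S.e i, x⟫_ℝ := by
  rw [inner_toH, negInv, S.e.inner_diag_comm S.exists_abs_inv_eig_le]
  exact S.inner_negInv x i

/-- The spectral projection in `H` onto finitely many eigenvectors. -/
def projH (s : Finset ι) : S.H →L[ℝ] S.H :=
  ∑ i ∈ s, (ContinuousLinearMap.toSpanSingleton ℝ (S.eig i • S.toH (S.e i))).comp
    (innerSL ℝ (S.toH (S.e i)))

theorem projH_apply (s : Finset ι) (x : S.H) :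
    S.projH s x = ∑ i ∈ s, ⟪S.toH (S.e i), x⟫_ℝ • S.eig i • S.toH (S.e i) := by
  simp [projH]

theorem isCompactOperator_projH (s : Finset ι) : IsCompactOperator (S.projH s) := by
  classical
  unfold projH
  induction s using Finset.induction_on with
  | empty =>
    rw [Finset.sum_empty]
    exact isCompactOperator_zero
  | insert i s hi ih =>
    rw [Finset.sum_insert hi]
    refine IsCompactOperator.add ?_ ih
    exact IsCompactOperator.clm_comp (f := innerSL ℝ (S.toH (S.e i)))
      (isCompactOperator_of_locallyCompactSpace_dom (innerSL ℝ (S.toH (S.e i))))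
      (ContinuousLinearMap.toSpanSingleton ℝ (S.eig i • S.toH (S.e i)))

theorem projH_toH (s : Finset ι) (x : F) :
    S.projH s (S.toH x) = S.toH (∑ i ∈ s, ⟪S.e i, x⟫_ℝ • S.e i) := by
  rw [projH_apply, ← toHₗ_apply _ (∑ i ∈ s, _), map_sum]
  refine Finset.sum_congr rfl fun i _ => ?_
  rw [inner_toH_e, map_smul, toHₗ_apply, smul_smul, mul_right_comm,
    inv_mul_cancel₀ (S.eig_pos i).ne', one_mul]

/-- Subtracting the projection kills exactly the coefficients indexed by `s`, so each finite partial
sum of the remaining norm runs over a set disjoint from `s`. -/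
theorem norm_toH_sub_projH_sq_le (s : Finset ι) (x : F) {B : ℝ}
    (h : ∀ t : Finset ι, Disjoint t s → ∑ i ∈ t, (S.eig i)⁻¹ * ⟪S.e i, x⟫_ℝ ^ 2 ≤ B) :
    ‖S.toH x - S.projH s (S.toH x)‖ ^ 2 ≤ B := by
  classical
  rw [projH_toH, ← toHₗ_apply, ← toHₗ_apply, ← map_sub, toHₗ_apply]
  refine hasSum_le_of_sum_le (S.hasSum_norm_toH_sq _) fun t => ?_
  have hcoef : ∀ i, ⟪S.e i, x - ∑ j ∈ s, ⟪S.e j, x⟫_ℝ • S.e j⟫_ℝ =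
      if i ∈ s then 0 else ⟪S.e i, x⟫_ℝ := fun i => by
    have ho := orthonormal_iff_ite.1 S.e.orthonormal
    simp only [inner_sub_right, inner_sum, inner_smul_right, ho, mul_ite, mul_one, mul_zero,
      Finset.sum_ite_eq]
    split_ifs <;> simp
  calc ∑ i ∈ t, (S.eig i)⁻¹ * ⟪S.e i, x - ∑ j ∈ s, ⟪S.e j, x⟫_ℝ • S.e j⟫_ℝ ^ 2
      = ∑ i ∈ t \ s, (S.eig i)⁻¹ * ⟪S.e i, x⟫_ℝ ^ 2 := by
        rw [Finset.sdiff_eq_filter, Finset.sum_filter]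
        refine Finset.sum_congr rfl fun i _ => ?_
        rw [hcoef]
        by_cases hi : i ∈ s <;> simp [hi]
    _ ≤ B := h _ Finset.sdiff_disjoint

/-- A spectral gap: positive eigenvalues with finitely many below any level are bounded away from
zero. -/
theorem exists_pos_le_rpow_eig {a : ℝ} (ha : 0 < a) : ∃ c, 0 < c ∧ ∀ i, c ≤ S.eig i ^ a := by
  obtain ⟨K, hK⟩ := S.exists_inv_eig_le
  refine ⟨(1 / max K 1) ^ a, by positivity, fun i => ?_⟩
  refine Real.rpow_le_rpow (by positivity) ?_ ha.le
  rw [one_div_le (by positivity) (S.eig_pos i)]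
  exact (hK i).trans (le_max_left _ _)

theorem rpow_one_div_pow_eig {n : ℕ} (hn : 1 ≤ n) (i : ι) :
    (S.eig i ^ (1 / (n : ℝ))) ^ n = S.eig i := by
  rw [one_div]
  exact Real.rpow_inv_natCast_pow (S.eig_pos i).le (by omega)

end Abstract

/-! ### Tail bounds and separation of points by the semigroup -/

section Lebesgue

variable {E : Type*} [MeasurableSpace E] {m : Measure E}
  {ι : Type*} {L : Lp ℝ 2 m →ₗ.[ℝ] Lp ℝ 2 m} (S : DiscreteSpectrum ι L)

/-- Every `exp (-t B) g` is of the form `(-L)⁻¹ y`. -/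
theorem exists_negInv_eq_semigroupOp {n : ℕ} (hn : 1 ≤ n) {t : ℝ} (ht : 0 < t) (g : Lp ℝ 2 m) :
    ∃ y, S.negInv y = semigroupOp S.e (fun i => S.eig i ^ (1 / (n : ℝ))) t g := by
  have hμ : ∀ i, 0 < S.eig i ^ (1 / (n : ℝ)) := fun i => Real.rpow_pos_of_pos (S.eig_pos i) _
  refine ⟨S.e.diag (fun i => (S.eig i ^ (1 / (n : ℝ))) ^ n *
    Real.exp (-(t * S.eig i ^ (1 / (n : ℝ))))) g, S.e.ext_inner fun i => ?_⟩
  rw [inner_negInv, S.e.inner_diag (exists_abs_pow_mul_exp_le hμ ht n), semigroupOp,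
    S.e.inner_diag ⟨1, abs_exp_neg_le hμ ht.le⟩, S.rpow_one_div_pow_eig hn, mul_assoc,
    inv_mul_cancel_left₀ (S.eig_pos i).ne']

variable [IsProbabilityMeasure m]

/-- Uniform smallness of the spectral tails of the `H`-norm relative to the `Lᵖ`-norm. -/
theorem exists_tail_bound (hL : IsSelfAdjoint L) {n : ℕ} (hn : 1 ≤ n)
    (hDir : IsDirichletOperator (-(S.negPow (1 / (n : ℝ))))) {d : ℝ} (hd : 0 < d)
    (hNash : NashInequality L d) {p : ℝ} (hp1 : 1 ≤ p) (hp2 : p ≤ 2)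
    (hdp : d * (2 / p - 1) < 2) :
    ∃ (K ρ : ℝ) (s : ℕ → Finset ι), 0 ≤ K ∧ 0 ≤ ρ ∧ ρ < 1 ∧ s 0 = ∅ ∧
      ∀ (N : ℕ) (f : Lp ℝ 2 m) (t : Finset ι), Disjoint t (s N) →
        ∑ i ∈ t, (S.eig i)⁻¹ * ⟪S.e i, f⟫_ℝ ^ 2 ≤
          K * ρ ^ N * (eLpNorm f (ENNReal.ofReal p) m).toReal ^ 2 := by
  have hn0 : (0 : ℝ) < n := by exact_mod_cast hn
  obtain ⟨a, ha, hμ⟩ := S.exists_pos_le_rpow_eig (one_div_pos.2 hn0)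
  obtain ⟨C, hC, hN⟩ := S.exists_diagNash hL hd hNash
  have hfin : ∀ N : ℕ, {i | S.eig i ^ (1 / (n : ℝ)) < a * 2 ^ N}.Finite := fun N => by
    refine (S.finite_eig_le ((a * 2 ^ N) ^ n)).subset fun i hi => ?_
    have := S.eig_pos i
    calc S.eig i = (S.eig i ^ (1 / (n : ℝ))) ^ n := (S.rpow_one_div_pow_eig hn i).symm
      _ ≤ _ := pow_le_pow_left₀ (by positivity) (le_of_lt hi) n
  have hN' : DiagNash S.e (fun i => (S.eig i ^ (1 / (n : ℝ))) ^ n) d C := by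
    simpa only [S.rpow_one_div_pow_eig hn] using hN
  obtain ⟨K, ρ, hK, hρ0, hρ1, h⟩ :=
    _root_.exists_tail_bound (S.diagDirichlet hDir) ha hμ hn hd hC hN' hp1 hp2 hdp
  refine ⟨K, ρ, fun N => (hfin N).toFinset, hK, hρ0, hρ1, ?_, fun N f t ht => ?_⟩
  -- At `N = 0` the threshold is `a`, a lower bound of the spectrum, so the tail is the full
  -- `H`-norm.
  · ext i
    simpa using hμ i
  · have := h N f t fun i hi => by
      have := Finset.disjoint_left.1 ht hi
      simpa using this
    simpa only [S.rpow_one_div_pow_eig hn] using this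

/-- Take `g = sign x`. Since `|T_t g| ≤ 1` uniformly in `t`, dominated convergence along `t → 0`
works although `x` is merely integrable, and the limit is `∫ |x|`. -/
theorem ae_eq_zero_of_integral_semigroupOp_mul_eq_zero {b : HilbertBasis ι ℝ (Lp ℝ 2 m)}
    {μ : ι → ℝ} (hD : DiagDirichlet b μ) (hμ : ∀ i, 0 < μ i) {x : E → ℝ} (hx : Integrable x m)
    (hxm : Measurable x)
    (h : ∀ t, 0 < t → ∀ g : Lp ℝ 2 m, ∫ ω, x ω * semigroupOp b μ t g ω ∂m = 0) :
    x =ᵐ[m] 0 := by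
  set σ : E → ℝ := fun ω => if 0 ≤ x ω then 1 else -1 with hσ
  have hσm : Measurable σ :=
    Measurable.ite (measurableSet_le measurable_const hxm) measurable_const measurable_const
  have hσ1 : ∀ ω, |σ ω| ≤ 1 := fun ω => by simp only [hσ]; split_ifs <;> simp
  have hσL : MemLp σ 2 m :=
    MemLp.of_bound hσm.aestronglyMeasurable 1 (Filter.Eventually.of_forall hσ1)
  set g : Lp ℝ 2 m := hσL.toLp
  have hg1 : ∀ᵐ ω ∂m, |g ω| ≤ 1 := by
    filter_upwards [hσL.coeFn_toLp] with ω hω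
    rw [hω]; exact hσ1 ω
  have ht0 : ∀ k : ℕ, (0 : ℝ) < 1 / (k + 1) := fun k => by positivity
  have hlim := b.tendsto_diag (φs := fun (k : ℕ) i => Real.exp (-(1 / ((k : ℝ) + 1) * μ i)))
    (φ := fun _ => 1) (K := 1) (fun k => abs_exp_neg_le hμ (ht0 k).le) (fun i => by simp)
    (fun i => by
      have := ((tendsto_one_div_add_atTop_nhds_zero_nat (𝕜 := ℝ)).mul_const (μ i)).neg.rexp
      simpa using this) g
  have hone : b.diag (fun _ => 1) g = g :=
    b.ext_inner fun i => by rw [b.inner_diag ⟨1, by simp⟩, one_mul]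
  rw [hone] at hlim
  obtain ⟨ns, -, hns⟩ := (tendstoInMeasure_of_tendsto_Lp hlim).exists_seq_tendsto_ae
  have hint : Filter.Tendsto (fun k => ∫ ω, x ω * semigroupOp b μ (1 / ((ns k : ℝ) + 1)) g ω ∂m)
      Filter.atTop (nhds (∫ ω, x ω * g ω ∂m)) := by
    refine tendsto_integral_of_dominated_convergence (fun ω => |x ω|) (fun k => ?_) hx.abs
      (fun k => ?_) ?_
    · exact hx.aestronglyMeasurable.mul (Lp.aestronglyMeasurable _)
    · filter_upwards [hD.abs_semigroupOp_le_one hμ (ht0 (ns k)) hg1] with ω hω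
      rw [norm_mul, Real.norm_eq_abs, Real.norm_eq_abs]
      exact mul_le_of_le_one_right (abs_nonneg _) hω
    · filter_upwards [hns] with ω hω
      exact hω.const_mul _
  simp only [h _ (ht0 _), tendsto_const_nhds_iff] at hint
  have habs : ∫ ω, |x ω| ∂m = 0 := by
    rw [hint]
    refine integral_congr_ae ?_
    filter_upwards [hσL.coeFn_toLp] with ω hω
    rw [hω]
    simp only [hσ]
    split_ifs with h0
    · rw [abs_of_nonneg h0, mul_one]
    · rw [abs_of_neg (not_le.1 h0)]; ring
  filter_upwards [(integral_eq_zero_iff_of_nonneg (fun ω => abs_nonneg (x ω)) hx.abs).1 habs]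
    with ω hω
  simpa using hω

end Lebesgue

end DiscreteSpectrum

end

/-! ### The embedding theorem -/

theorem lemma3p1 {E : Type*} [MeasurableSpace E] (m : Measure E) [IsProbabilityMeasure m]
    [IsSeparable m]
    (L : Lp ℝ 2 m →ₗ.[ℝ] Lp ℝ 2 m) (hL : IsSelfAdjoint L) (hneg : IsNegativeDefinite L)
    {ι : Type*} (S : DiscreteSpectrum ι L)
    (r : ℝ) [Fact (r ∈ Set.Ioo (0 : ℝ) 1)]
    (d : ℝ) (hd0 : 0 < d) (hd : d < 2 * (r + 1) / (1 - r)) (hNash : NashInequality L d)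
    (n : ℕ) (hn : 1 ≤ n) (hDir : IsDirichletOperator (-(S.negPow (1 / (n : ℝ))))) :
    -- the embedding `L^{r+1}(m) ⊂ H`, which extends the inclusion `L²(m) ⊂ H`
    ∃ J : Lp ℝ (ENNReal.ofReal (r + 1)) m →L[ℝ] S.H,
      (∀ (x : Lp ℝ (ENNReal.ofReal (r + 1)) m) (y : Lp ℝ 2 m), x =ᵐ[m] y → J x = S.toH y) ∧
      Function.Injective J ∧
      IsCompactOperator J ∧
      -- the extension of `(-L)⁻¹` to an operator from `L^{r+1}(m)` to `L^{(r+1)/r}(m)`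
      (∃ G : Lp ℝ (ENNReal.ofReal (r + 1)) m →L[ℝ] Lp ℝ (ENNReal.ofReal ((r + 1) / r)) m,
        (∀ (x : Lp ℝ (ENNReal.ofReal (r + 1)) m) (f : L.domain),
          x =ᵐ[m] (-(L f) : Lp ℝ 2 m) → G x =ᵐ[m] (f : Lp ℝ 2 m)) ∧
        ∀ x : Lp ℝ (ENNReal.ofReal (r + 1)) m, ‖J x‖ ^ 2 = ∫ ω, x ω * G x ω ∂m) ∧
      ∃ c : ℝ, 0 < c ∧
        ∀ x : Lp ℝ (ENNReal.ofReal (r + 1)) m, ‖J x‖ ≤ c * ‖x‖ := by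
  classical
  have hr : r ∈ Set.Ioo (0 : ℝ) 1 := Fact.out
  obtain ⟨hr0, hr1⟩ := hr
  have hpq : (r + 1).HolderConjugate ((r + 1) / r) := by
    rw [Real.holderConjugate_iff]
    refine ⟨by linarith, ?_⟩
    field_simp
    ring
  have hdp : d * (2 / (r + 1) - 1) < 2 := by
    rw [lt_div_iff₀ (by linarith)] at hd
    have : d * (2 / (r + 1) - 1) = d * (1 - r) / (r + 1) := by field_simp; ring
    rw [this, div_lt_iff₀ (by linarith)]
    exact hd
  have hn0 : (0 : ℝ) < n := by exact_mod_cast hn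
  obtain ⟨K, ρ, s, hK, hρ0, hρ1, hs0, htail⟩ :=
    S.exists_tail_bound hL hn hDir hd0 hNash (p := r + 1) (by linarith) (by linarith) hdp
  have hPle : ENNReal.ofReal (r + 1) ≤ 2 := by
    rw [← ENNReal.ofReal_ofNat]; exact ENNReal.ofReal_le_ofReal (by linarith)
  set incl : Lp ℝ 2 m →ₗ[ℝ] Lp ℝ (ENNReal.ofReal (r + 1)) m := lpInclusion hPle with hincl
  have hdense : DenseRange incl := denseRange_lpInclusion ENNReal.ofReal_ne_top hPle
  have hnorm : ∀ y, ‖incl y‖ = (eLpNorm y (ENNReal.ofReal (r + 1)) m).toReal :=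
    norm_lpInclusion hPle
  have hincl_ae : ∀ y, incl y =ᵐ[m] y := coeFn_lpInclusion hPle
  simp only [← hnorm] at htail
  have hprojN : ∀ (N : ℕ) (y : Lp ℝ 2 m),
      ‖S.toH y - S.projH (s N) (S.toH y)‖ ≤ √(K * ρ ^ N) * ‖incl y‖ := fun N y => by
    have h1 := S.norm_toH_sub_projH_sq_le (s N) y (htail N y)
    rw [← sq_le_sq₀ (norm_nonneg _) (by positivity), mul_pow, Real.sq_sqrt (by positivity)]
    exact h1
  -- Case `N = 0`: the projection vanishes because `s 0` is empty.
  have hbound : ∀ y, ‖S.toHₗ y‖ ≤ √K * ‖incl y‖ := fun y => by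
    have := hprojN 0 y
    rw [hs0, S.projH_apply, Finset.sum_empty, sub_zero, pow_zero, mul_one] at this
    exact this
  set J : Lp ℝ (ENNReal.ofReal (r + 1)) m →L[ℝ] S.H := S.toHₗ.extendOfNorm incl with hJ
  have hJincl : ∀ y, J (incl y) = S.toH y := fun y =>
    LinearMap.extendOfNorm_eq hdense ⟨√K, hbound⟩ y
  have hJle : ∀ x, ‖J x‖ ≤ √K * ‖x‖ := LinearMap.norm_extendOfNorm_apply_le hdense _ hbound
  have hincl_eq : ∀ (x : Lp ℝ (ENNReal.ofReal (r + 1)) m) (y : Lp ℝ 2 m), x =ᵐ[m] y →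
      x = incl y := fun x y h => Lp.ext (h.trans (hincl_ae y).symm)
  -- the inverse of `-L` maps into the dual exponent
  have hGnorm : ∀ y, eLpNorm (S.negInv y) (ENNReal.ofReal ((r + 1) / r)) m ≤
      ENNReal.ofReal (K * ‖incl y‖) := fun y => by
    refine eLpNorm_le_of_inner_le hpq (by positivity) fun z => ?_
    -- Cauchy–Schwarz in `H`, with the embedding bound used on both factors: `√K * √K = K`.
    rw [← S.inner_toH, ← hnorm]
    refine (real_inner_le_norm _ _).trans ((mul_le_mul (hbound y) (hbound z) (norm_nonneg _)
      (by positivity)).trans_eq ?_)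
    rw [mul_mul_mul_comm, Real.mul_self_sqrt hK, mul_assoc]
  have hGmem : ∀ y, MemLp (S.negInv y) (ENNReal.ofReal ((r + 1) / r)) m := fun y =>
    ⟨Lp.aestronglyMeasurable _, (hGnorm y).trans_lt ENNReal.ofReal_lt_top⟩
  let G₀ : Lp ℝ 2 m →ₗ[ℝ] Lp ℝ (ENNReal.ofReal ((r + 1) / r)) m :=
    { toFun := fun y => (hGmem y).toLp
      map_add' := fun y z => by
        rw [← MemLp.toLp_add]
        refine MemLp.toLp_congr _ _ ?_
        rw [map_add]
        exact Lp.coeFn_add _ _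
      map_smul' := fun c y => by
        rw [RingHom.id_apply, ← MemLp.toLp_const_smul]
        refine MemLp.toLp_congr _ _ ?_
        rw [map_smul]
        exact Lp.coeFn_smul _ _ }
  have hG₀ : ∀ y, ‖G₀ y‖ ≤ K * ‖incl y‖ := fun y => by
    change ‖(hGmem y).toLp‖ ≤ _
    rw [Lp.norm_toLp]
    exact ENNReal.toReal_le_of_le_ofReal (by positivity) (hGnorm y)
  set G := G₀.extendOfNorm incl with hG
  have hGincl : ∀ y, G (incl y) = G₀ y := LinearMap.extendOfNorm_eq hdense ⟨K, hG₀⟩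
  have hGae : ∀ y, G (incl y) =ᵐ[m] S.negInv y := fun y => by
    rw [hGincl]
    exact (hGmem y).coeFn_toLp
  have : ENNReal.HolderConjugate (ENNReal.ofReal (r + 1)) (ENNReal.ofReal ((r + 1) / r)) :=
    hpq.ennrealOfReal
  set pair := (ContinuousLinearMap.mul ℝ ℝ).lpPairing m (ENNReal.ofReal (r + 1))
    (ENNReal.ofReal ((r + 1) / r)) with hpair
  have hpair_eq : ∀ x g, pair x g = ∫ ω, x ω * g ω ∂m := fun x g => by
    rw [hpair, ContinuousLinearMap.lpPairing_eq_integral]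
    rfl
  -- The polarised norm identity, valid on `L²` and extended by density; it yields both injectivity
  -- and the formula for `‖J x‖ ^ 2`.
  have hpairJ : ∀ x z, pair x (G z) = ⟪J z, J x⟫_ℝ := by
    intro x z
    refine hdense.induction_on₂ (p := fun x z => pair x (G z) = ⟪J z, J x⟫_ℝ) ?_ ?_ x z
    · exact isClosed_eq (by fun_prop) (by fun_prop)
    · intro x z
      rw [hJincl, hJincl, S.inner_toH, hpair_eq, inner_L2_eq_integral]
      refine integral_congr_ae ?_
      filter_upwards [hincl_ae x, hGae z] with ω h1 h2
      rw [h1, h2, mul_comm]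
  refine ⟨J, fun x y h => by rw [hincl_eq x y h, hJincl], ?_, ?_, ⟨G, ?_, ?_⟩, √K + 1,
    by positivity, fun x => (hJle x).trans (by gcongr; linarith)⟩
  · refine (injective_iff_map_eq_zero J).2 fun x hx => ?_
    rw [Lp.eq_zero_iff_ae_eq_zero]
    refine DiscreteSpectrum.ae_eq_zero_of_integral_semigroupOp_mul_eq_zero (S.diagDirichlet hDir)
      (fun i => Real.rpow_pos_of_pos (S.eig_pos i) _)
      ((Lp.memLp x).integrable Fact.out) (Lp.stronglyMeasurable x).measurable fun t ht g => ?_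
    -- `J x = 0` makes `x` orthogonal to the range of `(-L)⁻¹` on `L²`, and `T_t g` lies in that
    -- range.
    obtain ⟨y, hy⟩ := S.exists_negInv_eq_semigroupOp hn ht g
    have h1 := hpairJ x (incl y)
    rw [hx, inner_zero_right, hpair_eq] at h1
    rw [← hy, ← h1]
    refine integral_congr_ae ?_
    filter_upwards [hGae y] with ω hω
    rw [hω]
  -- The approximants have finite rank, and their distance to `J` is at most `√(K * ρ ^ N)`.
  · refine isCompactOperator_of_norm_sub_le (T := fun N => (S.projH (s N)).comp J)
      (c := fun N => √(K * ρ ^ N)) (fun N => Real.sqrt_nonneg _) ?_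
      (fun N => (S.isCompactOperator_projH (s N)).comp_clm J) fun N x => ?_
    · have := ((tendsto_pow_atTop_nhds_zero_of_lt_one hρ0 hρ1).const_mul K).sqrt
      simpa using this
    · refine hdense.induction_on (p := fun x =>
        ‖J x - (S.projH (s N)).comp J x‖ ≤ √(K * ρ ^ N) * ‖x‖) x
        (isClosed_le (by fun_prop) (by fun_prop)) fun y => ?_
      rw [ContinuousLinearMap.comp_apply, hJincl]
      exact hprojN N y
  · intro x f h
    rw [hincl_eq x _ h]
    refine (hGae _).trans ?_
    have : S.negInv (-(L f)) = f := S.e.ext_inner fun i => by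
      rw [S.inner_negInv, inner_neg_right, S.inner_apply hL, neg_neg,
        inv_mul_cancel_left₀ (S.eig_pos i).ne']
    rw [this]
  · intro x
    rw [← hpair_eq, hpairJ, real_inner_self_eq_norm_sq]
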